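/- Setting. Let $X$ be a compact metric space and let $\underline{\mathcal H}$ be a real reproducing kernel Hilbert space of functions on $\underline X=X\times X$ whose reproducing kernel (hyper-kernel) $\underline k:\underline X\times\underline X\to\mathbb R$ is continuous, is symmetric in its first pair of arguments, $\underline k((x,y),w)=\underline k((y,x),w)$, and is such that every $\underline k(\underline x,\cdot)$ is a (symmetric, possibly indefinite) kernel on $X$ (a hyper-RKHS). Let $\rho$ be a probability measure on $X\times X\times\mathbb R$ of the form $d\rho(x,x',y)=d\rho_X(x)\,d\rho_X(x')\,d\rho(y|(x,x'))$, and let $k^*:X\times X\to\mathbb R$ be such that $k^*(x,x')$ is a median of $\rho(\cdot|(x,x'))$ for all $(x,x')$. Put $\mathcal E(k)=\int|y-k(x,x')|\,d\rho$ and, for a function $f$ on $X\times X$, $\|f\|_{L^{u}_{\rho_X}}=\big(\iint|f(x,x')|^{u}\,d\rho_X(x)\,d\rho_X(x')\big)^{1/u}$. For $m\ge1$ a sample $\mathbf z=\{(x_i,x_j,y_{ij})\}_{i,j=1}^m$ is obtained by drawing $x_1,\dots,x_m$ independently from $\rho_X$ and then, given these points, drawing the $y_{ij}$ independently from $\rho(\cdot|(x_i,x_j))$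 (so the $m^2$ triples are not independent). With $|u|_\varepsilon=0$ if $|u|<\varepsilon$ and $|u|_\varepsilon=|u|-\varepsilon$ otherwise, let $$k^{(\varepsilon)}_{\mathbf z,\lambda}=\operatorname*{arg\,min}_{k\in\underline{\mathcal H}}\Big\{\frac1{m^2}\sum_{i,j=1}^m|y_{ij}-k(x_i,x_j)|_\varepsilon+\lambda\|k\|^2_{\underline{\mathcal H}}\Big\},$$ and let $\pi_B(t)=\max\{-B,\min\{t,B\}\}$. Assumptions. (1) $|k^*(x,x')|\le M^*$ for $\rho_X\otimes\rho_X$-almost all $(x,x')$, for some constant $M^*\ge1$. (2) $\rho$ has a median of $p$-average type $q$ for some $p\in(0,\infty]$, $q\in(1,\infty)$: for every $(x,x')$ there are a median $t^*$ of $\rho(\cdot|(x,x'))$ and constants $0<a_{(x,x')}\le1$, $b_{(x,x')}>0$ such that $\rho((t^*-u,t^*)|(x,x'))\ge b_{(x,x')}u^{q-1}$ and $\rho((t^*,t^*+u)|(x,x'))\ge b_{(x,x')}u^{q-1}$ for all $u\in[0,a_{(x,x')}]$, and the function $(x,x')\mapsto(b_{(x,x')}a_{(x,x')}^{q-1})^{-1}$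 lies in $L^p_{\rho_X}$. (3) For some $0<r\le1$ and some constant $C_0$, $D(\lambda)=\inf_{k\in\underline{\mathcal H}}\{\mathcal E(k)-\mathcal E(k^*)+\lambda\|k\|^2_{\underline{\mathcal H}}\}\le C_0\lambda^r$ for all $\lambda>0$. (4) There are constants $M\ge1$, $c>0$ with $\int|y|^\ell\,d\rho(y|(x,x'))\le c\,\ell!\,M^\ell$ for all integers $\ell\ge1$ and all $(x,x')$. (5) For some $s>0$ and $C_s>0$, $\log\mathscr N(\mathcal B_1,\eta)\le C_s\eta^{-s}$ for all $\eta>0$, where $\mathscr N(\mathcal B_1,\eta)$ is the minimal number of disks of radius $\eta$ in $C(\underline X)$ (supremum norm) that cover the unit ball $\mathcal B_1$ of $\underline{\mathcal H}$. Let $\theta=\min\{\frac2q,\frac p{p+1}\}$ and $p^*=\frac{pq}{p+1}$ (with $\frac p{p+1}=1$ and $p^*=q$ if $p=\infty$), take $\lambda=m^{-\alpha}$ with $0<\alpha\le1$ and $\alpha<\frac{1+s}{s(2+s-\theta)}$, take $\varepsilon=m^{-\gamma}$ with $\alpha r\le\gamma\le\infty$ ($\varepsilon=0$ if $\gamma=\infty$),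 and set $$\Theta=\min\Big\{\alpha r,\ \frac{1+\alpha r-\alpha}{2-\theta},\ \frac1{2+s-\theta}-\frac{\alpha s}{1+s}\Big\}.$$ Theorem. For every $0<\epsilon<\Theta/q$ there is a constant $\widetilde C>0$, independent of $m$ and $\delta$, such that for all $m\ge1$ the minimizer $k^{(\varepsilon)}_{\mathbf z,\lambda}$ exists and is unique for every sample $\mathbf z$, and for all $0<\delta<1$, with probability at least $1-\delta$ over the sample, $$\big\|\pi_{M^*}(k^{(\varepsilon)}_{\mathbf z,\lambda})-k^*\big\|_{L^{p^*}_{\rho_X}}\le\widetilde C\Big(\log\frac4\delta\Big)^{1/q}m^{\epsilon-\Theta/q}.$$ -/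

import Mathlib

open MeasureTheory ProbabilityTheory Set
open scoped ENNReal NNReal

namespace HyperSVR

section HyperRKHS

/-! ### Hyper-RKHS -/

variable {X : Type*} (H : Type*) [NormedAddCommGroup H] [InnerProductSpace ℝ H] [CompleteSpace H]
  [RKHS ℝ H (X × X) ℝ]

/-- The (scalar) reproducing kernel of a real RKHS of functions on `X × X`. It satisfies
`⟪k, hyperkernel z ·⟫ = k z` (`RKHS.inner_kerFun`), and the functions `hyperkernel z ·`
span a dense subspace (`RKHS.kerFun_dense`). -/
noncomputable def hyperkernel (z w : X × X) : ℝ := RKHS.kernel H z w 1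

/-- A (general, possibly indefinite) kernel on `X`: a symmetric real function on `X × X`.
Positive semidefinite kernels are a special case. -/
def IsKernel (k : X × X → ℝ) : Prop := ∀ x y : X, k (x, y) = k (y, x)

/-- The RKHS `H` of functions on `X × X` is a hyper-RKHS with continuous hyper-kernel. The
reproducing property and the density of the span are part of `RKHS`. -/
structure IsHyperRKHS [TopologicalSpace X] : Prop where
  /-- the hyper-kernel is symmetric in its first pair of arguments -/
  symm_left : ∀ (x y : X) (w : X × X), hyperkernel H (x, y) w = hyperkernel H (y, x) w
  /-- the hyper-kernel is a kernel in its second pair of arguments -/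
  isKernel_right : ∀ z : X × X, IsKernel (fun w => hyperkernel H z w)
  /-- the hyper-kernel is continuous -/
  continuous_hyperkernel :
    Continuous (fun zw : (X × X) × (X × X) => hyperkernel H zw.1 zw.2)

/-- The ball `{k ∈ H : ‖k‖_H ≤ R}`, as a subset of the space `C(X × X, ℝ)` with the
supremum norm. -/
def hyperBall [TopologicalSpace X] (R : ℝ) : Set C(X × X, ℝ) :=
  {g | ∃ k : H, ‖k‖ ≤ R ∧ ∀ z, g z = k z}

/-- `log N(B₁, η) ≤ C_s (1/η)^s` for all `η > 0`, where `N(B₁, η) ∈ ℕ ∪ {∞}` is the minimal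
number of disks of radius `η` of `C(X × X, ℝ)` that cover the unit ball of `H`. -/
def CoveringCondition [TopologicalSpace X] [CompactSpace X] (s : ℝ) : Prop :=
  ∃ Cs : ℝ, 0 < Cs ∧ ∀ η : ℝ≥0, 0 < η →
    ENNReal.log ((Metric.externalCoveringNumber η (hyperBall (X := X) H 1) : ℕ∞) : ℝ≥0∞)
      ≤ ((Cs * (1 / (η : ℝ)) ^ s : ℝ) : EReal)

end HyperRKHS

section Distribution

/-! ### The distribution: conditional law `ρc (x, x')` of `y` given `(x, x')`, marginal `ρX` -/

variable {X : Type*} [MeasurableSpace X]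

/-- `t` is a median of the probability measure `μ`. -/
def IsMedian (μ : Measure ℝ) (t : ℝ) : Prop := 1 / 2 ≤ μ (Iic t) ∧ 1 / 2 ≤ μ (Ici t)

/-- Moment hypothesis: `∫ |y|^ℓ dρ(y | x, x') ≤ c ℓ! M^ℓ` for all `ℓ ≥ 1` and all `(x, x')`. -/
def MomentHypothesis (ρc : Kernel (X × X) ℝ) : Prop :=
  ∃ M c : ℝ, 1 ≤ M ∧ 0 < c ∧ ∀ ℓ : ℕ, 1 ≤ ℓ → ∀ z : X × X,
    ∫⁻ y, ENNReal.ofReal (|y| ^ ℓ) ∂(ρc z) ≤ ENNReal.ofReal (c * (ℓ.factorial : ℝ) * M ^ ℓ)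

/-- The distribution has a median of `p`-average type `q`. -/
def HasMedianOfAverageType (ρX : Measure X) (ρc : Kernel (X × X) ℝ) (p : ℝ≥0∞) (q : ℝ) : Prop :=
  ∃ t a b : X × X → ℝ,
    (∀ z, IsMedian (ρc z) (t z) ∧ 0 < a z ∧ a z ≤ 1 ∧ 0 < b z ∧
      ∀ u ∈ Icc 0 (a z),
        ENNReal.ofReal (b z * u ^ (q - 1)) ≤ ρc z (Ioo (t z - u) (t z)) ∧
        ENNReal.ofReal (b z * u ^ (q - 1)) ≤ ρc z (Ioo (t z) (t z + u))) ∧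
    MemLp (fun z => (b z * a z ^ (q - 1))⁻¹) p (ρX.prod ρX)

/-- The expected risk `𝓔(f) = ∫ |y - f(x, x')| dρ`, with
`dρ = dρc(y | x, x') dρX(x) dρX(x')`. -/
noncomputable def risk (ρX : Measure X) (ρc : Kernel (X × X) ℝ) (f : X × X → ℝ) : ℝ :=
  ∫ z, |z.2 - f z.1| ∂((ρX.prod ρX) ⊗ₘ ρc)

/-- The regularization error `D(lam) = inf_{k ∈ H} {𝓔(k) - 𝓔(k*) + lam ‖k‖²}`. -/
noncomputable def regError (H : Type*) [NormedAddCommGroup H] [InnerProductSpace ℝ H]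
    [RKHS ℝ H (X × X) ℝ] (ρX : Measure X) (ρc : Kernel (X × X) ℝ)
    (kstar : X × X → ℝ) (lam : ℝ) : ℝ :=
  ⨅ k : H, (risk ρX ρc k - risk ρX ρc kstar + lam * ‖k‖ ^ 2)

/-- The target `k*` is approximated by `H` with exponent `r`. -/
def ApproxCondition (H : Type*) [NormedAddCommGroup H] [InnerProductSpace ℝ H]
    [RKHS ℝ H (X × X) ℝ] (ρX : Measure X) (ρc : Kernel (X × X) ℝ)
    (kstar : X × X → ℝ) (r : ℝ) : Prop :=
  ∃ C₀ : ℝ, ∀ lam : ℝ, 0 < lam → regError H ρX ρc kstar lam ≤ C₀ * lam ^ r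

end Distribution

section Sample

/-! ### The pairwise samples and the learning algorithm -/

/-- A pairwise sample: points `x_i` and labels `y_ij`. -/
abbrev Sample (X : Type*) (m : ℕ) : Type _ := (Fin m → X) × (Fin m × Fin m → ℝ)

variable {X : Type*} [MeasurableSpace X]

/-- Given the points `x_i`, the labels `y_ij` are independent with laws `ρc (x_i, x_j)`. -/
noncomputable def labelKernel (ρc : Kernel (X × X) ℝ) [IsMarkovKernel ρc] (m : ℕ) :
    Kernel (Fin m → X) (Fin m × Fin m → ℝ) where
  toFun x := Measure.pi fun ij => ρc (x ij.1, x ij.2)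
  measurable' := by
    refine Measurable.measure_of_isPiSystem_of_isProbabilityMeasure
      generateFrom_pi.symm isPiSystem_pi ?_
    rintro _ ⟨s, hs, rfl⟩
    simp only [Measure.pi_pi]
    refine Finset.measurable_prod _ fun ij _ => ?_
    exact (Kernel.measurable_coe ρc (hs ij (mem_univ _))).comp (by fun_prop)

instance (ρc : Kernel (X × X) ℝ) [IsMarkovKernel ρc] (m : ℕ) :
    IsMarkovKernel (labelKernel ρc m) :=
  ⟨fun x => by
    change IsProbabilityMeasure (Measure.pi fun ij : Fin m × Fin m => ρc (x ij.1, x ij.2))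
    infer_instance⟩

/-- The law of the sample: `x_1, …, x_m` are drawn independently from `ρX`, and then `y_ij`
from `ρc (x_i, x_j)`. -/
noncomputable def sampleLaw (ρX : Measure X) (ρc : Kernel (X × X) ℝ) [IsMarkovKernel ρc]
    (m : ℕ) : Measure (Sample X m) :=
  (Measure.pi fun _ : Fin m => ρX) ⊗ₘ labelKernel ρc m

/-- The `ε`-insensitive loss `|u|_ε`. -/
noncomputable def insensitiveLoss (ε u : ℝ) : ℝ := if |u| < ε then 0 else |u| - ε

variable {H : Type*} [NormedAddCommGroup H] [InnerProductSpace ℝ H] [RKHS ℝ H (X × X) ℝ]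

/-- The regularized empirical risk of SVR. -/
noncomputable def svrObjective {m : ℕ} (lam ε : ℝ) (S : Sample X m) (k : H) : ℝ :=
  1 / (m : ℝ) ^ 2 * ∑ i : Fin m, ∑ j : Fin m, insensitiveLoss ε (S.2 (i, j) - k (S.1 i, S.1 j))
    + lam * ‖k‖ ^ 2

/-- `k` is a minimizer over `H` of the regularized empirical risk. -/
def IsSVRSolution {m : ℕ} (lam ε : ℝ) (S : Sample X m) (k : H) : Prop :=
  ∀ k' : H, svrObjective lam ε S k ≤ svrObjective lam ε S k'

/-- The projection operator `π_B`, on values. -/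
noncomputable def proj (B t : ℝ) : ℝ := if B < t then B else if t < -B then -B else t

/-- The insensitivity parameter `ε = m^{-γ}` for `γ ∈ [0, ∞]`, with `m^{-∞} = 0`. -/
noncomputable def insensitivity (γ : ℝ≥0∞) (m : ℕ) : ℝ :=
  if γ = ∞ then 0 else (m : ℝ) ^ (-γ.toReal)

end Sample

/-! ### Exponents -/

/-- `p / (p + 1)` for `p ∈ (0, ∞]`, equal to `1` for `p = ∞`. -/
noncomputable def pRatio (p : ℝ≥0∞) : ℝ≥0∞ := (1 + p⁻¹)⁻¹

/-- `p* = p q / (p + 1)`, equal to `q` for `p = ∞`. -/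
noncomputable def pStar (p : ℝ≥0∞) (q : ℝ) : ℝ≥0∞ := pRatio p * ENNReal.ofReal q

/-- `θ = min {2 / q, p / (p + 1)}`. -/
noncomputable def theta (p : ℝ≥0∞) (q : ℝ) : ℝ := min (2 / q) (pRatio p).toReal

/-- `Θ = min {α r, (1 + α r - α) / (2 - θ), 1 / (2 + s - θ) - α s / (1 + s)}`. -/
noncomputable def powerIndex (p : ℝ≥0∞) (q r s α : ℝ) : ℝ :=
  min (α * r) (min ((1 + α * r - α) / (2 - theta p q))
    (1 / (2 + s - theta p q) - α * s / (1 + s)))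

end HyperSVR

open HyperSVR

/-! The proof is an oracle inequality for the excess risk, with a variance bound supplied by the
noise condition. Three difficulties shape it.

Dependence. The `m²` triples share points. The mean over off-diagonal pairs is a U-statistic, and
averaging over permutations writes it as an average of means over `m / 2` disjoint pairs, which are
independent. Convexity of the exponential (`exp_offDiagMean_le`) then transfers Bernstein-type
bounds with effective sample size `m / 2` (`sampleLaw_offDiagMean_gt_le`). Differences of losses are
bounded, so the diagonal costs only a multiple of `1 / m`, up to the sup bounds.

Noise. Mass near the median makes the conditional excess at `z` dominate `|g z - k* z| ^ q`, up to
the weight `(b a^(q-1))⁻¹`. Hölder against this `L^p` weight bounds the `L^{p*}` error by the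
excess. Comparison with `L²` gives variance at most a constant times excess to the power `θ`
(`excess_bounds_of_averageType`). The same estimate converts the final excess bound into the norm
bound.

Unbounded labels. The minimizer is first projected at the level `B = B₀ (1 + log m)`, above which
the exponential moments make the total overshoot of the labels negligible. Projecting further to
`M*` only brings it closer to `k*`. The resulting factor `1 + log m` is absorbed by `m^ϵ`.

In `exists_event_excess_le`, comparison with zero confines the minimizer to a ball of radius about
`m^(α/2)`; a net of this ball at scale `t` with a union bound controls it uniformly, while a
near-minimizer `k₀` of the regularization error needs only one deviation bound. `exists_excess_rate`
takes `t` of order `m^(-Θ)`, up to logarithms. In `Θ` the first term is the approximation error, the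
second pays for the deviation at `k₀`, whose norm may grow like `m^(α(1-r)/2)`, and the third pays
for the entropy. -/

namespace HyperSVR

/-! ### Independence of the triples indexed by disjoint pairs. -/

section Independence

theorem lintegral_pi_prod_comp {ι κ Ω : Type*} [Fintype ι] [Fintype κ] [MeasurableSpace Ω]
    (μ : ι → Measure Ω) [∀ i, IsProbabilityMeasure (μ i)] (e : κ → ι) (he : e.Injective)
    (f : κ → Ω → ℝ≥0∞) (hf : ∀ l, Measurable (f l)) :
    ∫⁻ y, ∏ l, f l (y (e l)) ∂Measure.pi μ = ∏ l, ∫⁻ t, f l t ∂μ (e l) := by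
  have h1 : iIndepFun (fun i (ω : ι → Ω) => ω i) (Measure.pi μ) :=
    iIndepFun_pi (X := fun _ => id) (fun _ => aemeasurable_id)
  have h2 := (h1.precomp he).comp f hf
  have h3 := lintegral_prod_eq_prod_lintegral_of_indepFun Finset.univ _ h2
    (fun l => (hf l).comp (measurable_pi_apply _))
  refine h3.trans (Finset.prod_congr rfl fun l _ => ?_)
  exact (measurePreserving_eval μ (e l)).lintegral_comp (hf l)

variable {X : Type*} [MeasurableSpace X]

/-- Injectivity of `e` on the sum type means that the `n` pairs use `2n` distinct coordinates;
regrouping these coordinates turns the product measure into `n` independent copies of `ρX.prod ρX`.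
-/
theorem lintegral_pi_prod_disjoint_pairs {m n : ℕ} (ρX : Measure X) [IsProbabilityMeasure ρX]
    (e : Fin n ⊕ Fin n → Fin m) (he : e.Injective) (G : X × X → ℝ≥0∞) (hG : Measurable G) :
    ∫⁻ x, ∏ l, G (x (e (.inl l)), x (e (.inr l))) ∂(Measure.pi fun _ : Fin m => ρX)
      = (∫⁻ z, G z ∂(ρX.prod ρX)) ^ n := by
  have h1 : iIndepFun (fun i (ω : Fin m → X) => ω i) (Measure.pi fun _ : Fin m => ρX) :=
    iIndepFun_pi (X := fun _ => id) (fun _ => aemeasurable_id)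
  have h2 := (iIndepFun_iff_map_fun_eq_pi_map
    (fun i => (measurable_pi_apply (e i)).aemeasurable)).1 (h1.precomp he)
  have h3 : MeasurePreserving (fun (x : Fin m → X) (i : Fin n ⊕ Fin n) => x (e i))
      (Measure.pi fun _ : Fin m => ρX) (Measure.pi fun _ : Fin n ⊕ Fin n => ρX) := by
    refine ⟨by fun_prop, h2.trans ?_⟩
    congr 1
    ext i : 1
    exact (measurePreserving_eval (fun _ : Fin m => ρX) (e i)).map_eq
  have h4 := measurePreserving_sumPiEquivProdPi (fun _ : Fin n ⊕ Fin n => ρX)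
  have h5 := (measurePreserving_arrowProdEquivProdArrow X X (Fin n)
    (fun _ => ρX) (fun _ => ρX)).symm
  have h6 := (h5.comp (h4.comp h3)).lintegral_comp
    (f := fun w : Fin n → X × X => ∏ l, G (w l))
    (Finset.measurable_prod _ fun l _ => hG.comp (measurable_pi_apply l))
  have h7 := lintegral_pi_prod_comp (fun _ : Fin n => ρX.prod ρX) id Function.injective_id
    (fun _ => G) (fun _ => hG)
  simp only [id, Finset.prod_const, Finset.card_univ, Fintype.card_fin] at h7
  rw [← h7, ← h6]
  rfl

theorem lintegral_sampleLaw {m : ℕ} (ρX : Measure X) [IsProbabilityMeasure ρX]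
    (ρc : Kernel (X × X) ℝ) [IsMarkovKernel ρc] {f : Sample X m → ℝ≥0∞} (hf : Measurable f) :
    ∫⁻ S, f S ∂sampleLaw ρX ρc m =
      ∫⁻ x, ∫⁻ y, f (x, y) ∂(Measure.pi fun ij : Fin m × Fin m => ρc (x ij.1, x ij.2))
        ∂(Measure.pi fun _ : Fin m => ρX) :=
  Measure.lintegral_compProd hf

instance (ρX : Measure X) [IsProbabilityMeasure ρX] (ρc : Kernel (X × X) ℝ) [IsMarkovKernel ρc]
    (m : ℕ) : IsProbabilityMeasure (sampleLaw ρX ρc m) := by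
  unfold sampleLaw; infer_instance

theorem lintegral_sampleLaw_prod_disjoint_pairs {m n : ℕ} (ρX : Measure X)
    [IsProbabilityMeasure ρX] (ρc : Kernel (X × X) ℝ) [IsMarkovKernel ρc]
    (e : Fin n ⊕ Fin n → Fin m) (he : e.Injective) (F : (X × X) × ℝ → ℝ≥0∞) (hF : Measurable F) :
    ∫⁻ S, ∏ l, F ((S.1 (e (.inl l)), S.1 (e (.inr l))), S.2 (e (.inl l), e (.inr l)))
        ∂sampleLaw ρX ρc m
      = (∫⁻ w, F w ∂((ρX.prod ρX) ⊗ₘ ρc)) ^ n := by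
  rw [lintegral_sampleLaw, Measure.lintegral_compProd hF,
    ← lintegral_pi_prod_disjoint_pairs ρX e he _ (hF.lintegral_kernel_prod_right' (κ := ρc))]
  · refine lintegral_congr fun x => ?_
    refine lintegral_pi_prod_comp (fun ij : Fin m × Fin m => ρc (x ij.1, x ij.2))
      (fun l : Fin n => (e (.inl l), e (.inr l))) (fun l l' h => ?_)
      (fun l t => F ((x (e (.inl l)), x (e (.inr l))), t)) (fun l => by fun_prop)
    simpa using he (Prod.mk.inj h).1
  · fun_prop

end Independence

/-! ### Hoeffding's averaging of a U-statistic over permutations. -/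

section Permutations

/-- The mean of an array over its off-diagonal entries. -/
noncomputable def offDiagMean {m : ℕ} (g : Fin m → Fin m → ℝ) : ℝ :=
  (∑ p ∈ Finset.univ.offDiag, g p.1 p.2) / ((m : ℝ) * (m - 1))

theorem exists_perm_map_pair {m : ℕ} {a b a' b' : Fin m} (h : a ≠ b) (h' : a' ≠ b') :
    ∃ τ : Equiv.Perm (Fin m), τ a = a' ∧ τ b = b' := by
  have h1 : Equiv.swap a a' b ≠ a' := by
    intro h2
    have := (Equiv.swap a a').injective (h2.trans (Equiv.swap_apply_left a a').symm)
    exact h this.symm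
  refine ⟨(Equiv.swap a a').trans (Equiv.swap (Equiv.swap a a' b) b'), ?_, ?_⟩
  · simp [Equiv.swap_apply_of_ne_of_ne h1.symm h']
  · simp

/-- The symmetric group is 2-transitive, so the sum does not depend on the chosen pair of distinct
indices; averaging it over all such pairs gives the value. -/
theorem sum_perm_apply_pair {m : ℕ} (g : Fin m → Fin m → ℝ) {a b : Fin m} (hab : a ≠ b) :
    ∑ σ : Equiv.Perm (Fin m), g (σ a) (σ b) = (m.factorial : ℝ) * offDiagMean g := by
  have key : ∀ p ∈ (Finset.univ : Finset (Fin m)).offDiag,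
      ∑ σ : Equiv.Perm (Fin m), g (σ p.1) (σ p.2) = ∑ σ : Equiv.Perm (Fin m), g (σ a) (σ b) := by
    rintro ⟨a', b'⟩ hp
    obtain ⟨τ, rfl, rfl⟩ := exists_perm_map_pair hab (Finset.mem_offDiag.1 hp).2.2
    exact Fintype.sum_equiv (Equiv.mulRight τ) _ _ (fun σ => rfl)
  have h1 : ∑ p ∈ (Finset.univ : Finset (Fin m)).offDiag,
      ∑ σ : Equiv.Perm (Fin m), g (σ p.1) (σ p.2)
      = (m.factorial : ℝ) * ∑ p ∈ (Finset.univ : Finset (Fin m)).offDiag, g p.1 p.2 := by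
    rw [Finset.sum_comm, Finset.sum_congr rfl (g := fun _ =>
      ∑ p ∈ (Finset.univ : Finset (Fin m)).offDiag, g p.1 p.2)]
    · simp [Fintype.card_perm]
    · intro σ _
      refine Finset.sum_equiv (σ.prodCongr σ) (fun p => ?_) (fun p _ => rfl)
      simp [Finset.mem_offDiag]
  have hm : 2 ≤ m := by
    have := Fintype.one_lt_card_iff.2 ⟨a, b, hab⟩
    simp only [Fintype.card_fin] at this
    omega
  have h3 : ((m : ℝ) * (m - 1)) ≠ 0 := by
    have : (2 : ℝ) ≤ m := by exact_mod_cast hm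
    apply mul_ne_zero <;> linarith
  have h2 : (((Finset.univ : Finset (Fin m)).offDiag.card : ℕ) : ℝ) = (m : ℝ) * (m - 1) := by
    rw [Finset.offDiag_card, Nat.cast_sub (by simpa using Nat.le_mul_self m)]
    simp; ring
  rw [Finset.sum_congr rfl key, Finset.sum_const, nsmul_eq_mul, h2] at h1
  rw [offDiagMean, mul_div_assoc', eq_div_iff h3, ← h1]
  ring

/-- Jensen's inequality for the uniform average over permutations. On the right each summand is a
product over disjoint pairs, hence factorizes in expectation. -/
theorem exp_offDiagMean_le {m n : ℕ} (hn : 0 < n) (g : Fin m → Fin m → ℝ) (τ : ℝ)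
    (e : Fin n ⊕ Fin n → Fin m) (he : e.Injective) :
    Real.exp (n * (τ * offDiagMean g)) ≤
      ∑ σ : Equiv.Perm (Fin m), (m.factorial : ℝ)⁻¹ *
        ∏ l : Fin n, Real.exp (τ * g (σ (e (.inl l))) (σ (e (.inr l)))) := by
  have hf : (m.factorial : ℝ) ≠ 0 := by positivity
  have h1 : (n : ℝ) * (τ * offDiagMean g) = ∑ σ : Equiv.Perm (Fin m), (m.factorial : ℝ)⁻¹ •
      ∑ l : Fin n, (τ * g (σ (e (.inl l))) (σ (e (.inr l)))) := by
    simp only [smul_eq_mul]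
    rw [← Finset.mul_sum, Finset.sum_comm]
    simp_rw [← Finset.mul_sum]
    rw [Finset.sum_congr rfl (fun l _ => sum_perm_apply_pair g
      (a := e (.inl l)) (b := e (.inr l)) (fun h => by simpa using he h))]
    simp
    field_simp
  rw [h1]
  refine (convexOn_exp.map_sum_le (fun _ _ => by positivity) ?_ (fun _ _ => mem_univ _)).trans ?_
  · simp [Fintype.card_perm, hf]
  · refine Finset.sum_le_sum fun σ _ => ?_
    rw [Real.exp_sum, smul_eq_mul]

end Permutations

/-! ### Chernoff bounds for the pairwise sample. -/

section Concentration

variable {X : Type*} [MeasurableSpace X]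

theorem sampleLaw_offDiagMean_gt_le {m : ℕ} (hm : 2 ≤ m) (ρX : Measure X)
    [IsProbabilityMeasure ρX] (ρc : Kernel (X × X) ℝ) [IsMarkovKernel ρc]
    (F : (X × X) × ℝ → ℝ) (hF : Measurable F) (τ v u : ℝ) (hτ : 0 ≤ τ)
    (hv : ∫⁻ w, ENNReal.ofReal (Real.exp (τ * F w)) ∂((ρX.prod ρX) ⊗ₘ ρc)
      ≤ ENNReal.ofReal (Real.exp v)) :
    sampleLaw ρX ρc m {S | u < offDiagMean (fun i j => F ((S.1 i, S.1 j), S.2 (i, j)))}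
      ≤ ENNReal.ofReal (Real.exp ((m / 2 : ℕ) * (v - τ * u))) := by
  set n := m / 2 with hn
  have hn0 : 0 < n := by omega
  obtain ⟨e⟩ : Nonempty (Fin n ⊕ Fin n ↪ Fin m) := by
    apply Function.Embedding.nonempty_of_card_le
    simp; omega
  have hmeas : Measurable fun S : Sample X m =>
      offDiagMean (fun i j => F ((S.1 i, S.1 j), S.2 (i, j))) := by
    unfold offDiagMean
    refine Measurable.div_const ?_ _
    refine Finset.measurable_sum _ fun p _ => ?_
    fun_prop
  have hint : ∫⁻ S, ENNReal.ofReal (Real.exp (n * (τ * offDiagMean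
      (fun i j => F ((S.1 i, S.1 j), S.2 (i, j)))))) ∂sampleLaw ρX ρc m
      ≤ ENNReal.ofReal (Real.exp (n * v)) := by
    have hσ : ∀ σ : Equiv.Perm (Fin m), ∫⁻ S, ∏ l : Fin n, ENNReal.ofReal (Real.exp (τ *
        F ((S.1 (σ (e (.inl l))), S.1 (σ (e (.inr l)))), S.2 (σ (e (.inl l)), σ (e (.inr l))))))
        ∂sampleLaw ρX ρc m ≤ ENNReal.ofReal (Real.exp (n * v)) := by
      intro σ
      rw [lintegral_sampleLaw_prod_disjoint_pairs ρX ρc (fun i => σ (e i))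
        (σ.injective.comp e.injective) (fun w => ENNReal.ofReal (Real.exp (τ * F w)))
        (by fun_prop)]
      rw [Real.exp_nat_mul, ENNReal.ofReal_pow (Real.exp_pos _).le]
      gcongr
    calc _ ≤ ∫⁻ S, ∑ σ : Equiv.Perm (Fin m), ENNReal.ofReal (m.factorial : ℝ)⁻¹ *
          ∏ l : Fin n, ENNReal.ofReal (Real.exp (τ * F ((S.1 (σ (e (.inl l))),
            S.1 (σ (e (.inr l)))), S.2 (σ (e (.inl l)), σ (e (.inr l))))))
            ∂sampleLaw ρX ρc m := by
          refine lintegral_mono fun S => ?_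
          refine (ENNReal.ofReal_le_ofReal (exp_offDiagMean_le hn0
            (fun i j => F ((S.1 i, S.1 j), S.2 (i, j))) τ e e.injective)).trans_eq ?_
          rw [ENNReal.ofReal_sum_of_nonneg (fun σ _ => by positivity)]
          refine Finset.sum_congr rfl fun σ _ => ?_
          rw [ENNReal.ofReal_mul (by positivity),
            ENNReal.ofReal_prod_of_nonneg (fun l _ => (Real.exp_pos _).le)]
      _ = ∑ σ : Equiv.Perm (Fin m), ENNReal.ofReal (m.factorial : ℝ)⁻¹ * ∫⁻ S,
          ∏ l : Fin n, ENNReal.ofReal (Real.exp (τ * F ((S.1 (σ (e (.inl l))),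
            S.1 (σ (e (.inr l)))), S.2 (σ (e (.inl l)), σ (e (.inr l))))))
            ∂sampleLaw ρX ρc m := by
          rw [lintegral_finsetSum _ (fun σ _ => by fun_prop)]
          refine Finset.sum_congr rfl fun σ _ => ?_
          rw [lintegral_const_mul _ (by fun_prop)]
      _ ≤ ∑ σ : Equiv.Perm (Fin m), ENNReal.ofReal (m.factorial : ℝ)⁻¹ *
          ENNReal.ofReal (Real.exp (n * v)) := by
          gcongr with σ _
          exact hσ σ
      _ = _ := by
          rw [Finset.sum_const, Finset.card_univ, Fintype.card_perm, Fintype.card_fin,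
            nsmul_eq_mul, ← mul_assoc, ← ENNReal.ofReal_natCast, ← ENNReal.ofReal_mul (by positivity),
            mul_inv_cancel₀ (by positivity)]
          simp
  have hsub : {S : Sample X m | u < offDiagMean (fun i j => F ((S.1 i, S.1 j), S.2 (i, j)))} ⊆
      {S | ENNReal.ofReal (Real.exp (n * (τ * u))) ≤ ENNReal.ofReal (Real.exp (n * (τ *
        offDiagMean (fun i j => F ((S.1 i, S.1 j), S.2 (i, j))))))} := by
    intro S hS
    simp only [mem_ofPred_eq] at hS ⊢
    gcongr
  refine (measure_mono hsub).trans ?_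
  refine (meas_ge_le_lintegral_div ?_ (by positivity) (by simp)).trans ?_
  · exact (Real.measurable_exp.comp ((hmeas.const_mul τ).const_mul _)).ennreal_ofReal.aemeasurable
  refine (ENNReal.div_le_div_right hint _).trans_eq ?_
  rw [← ENNReal.ofReal_div_of_pos (Real.exp_pos _), ← Real.exp_sub]
  congr 2
  ring

/-- No decoupling is needed here: given the points, all `m²` labels are independent, and the bound
on the exponential moment is uniform in `z`. -/
theorem sampleLaw_sum_label_gt_le {m : ℕ} (ρX : Measure X)
    [IsProbabilityMeasure ρX] (ρc : Kernel (X × X) ℝ) [IsMarkovKernel ρc]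
    (ψ : ℝ → ℝ) (hψ : Measurable ψ) (a L : ℝ)
    (ha : ∀ z, ∫⁻ y, ENNReal.ofReal (Real.exp (ψ y)) ∂(ρc z) ≤ ENNReal.ofReal (Real.exp a)) :
    sampleLaw ρX ρc m {S | (m : ℝ) ^ 2 * a + L < ∑ i : Fin m, ∑ j : Fin m, ψ (S.2 (i, j))}
      ≤ ENNReal.ofReal (Real.exp (-L)) := by
  have hint : ∫⁻ S : Sample X m, ENNReal.ofReal (Real.exp (∑ i : Fin m, ∑ j : Fin m, ψ (S.2 (i, j))))
      ∂sampleLaw ρX ρc m ≤ ENNReal.ofReal (Real.exp ((m : ℝ) ^ 2 * a)) := by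
    rw [lintegral_sampleLaw ρX ρc (by fun_prop)]
    refine (lintegral_mono (g := fun _ => ENNReal.ofReal (Real.exp ((m : ℝ) ^ 2 * a)))
      fun x => ?_).trans_eq (by simp)
    have h1 := lintegral_pi_prod_comp (fun ij : Fin m × Fin m => ρc (x ij.1, x ij.2)) id
      Function.injective_id (fun _ y => ENNReal.ofReal (Real.exp (ψ y))) (fun _ => by fun_prop)
    simp only [id] at h1
    calc _ = _ := lintegral_congr fun y => by
          rw [← Fintype.sum_prod_type' (fun i j => ψ (y (i, j))), Real.exp_sum,
            ENNReal.ofReal_prod_of_nonneg (fun l _ => (Real.exp_pos _).le)]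
      _ = _ := h1
      _ ≤ ∏ _ij : Fin m × Fin m, ENNReal.ofReal (Real.exp a) :=
          Finset.prod_le_prod' fun ij _ => ha _
      _ = _ := by
          rw [Finset.prod_const, Finset.card_univ, Fintype.card_prod, Fintype.card_fin,
            ← ENNReal.ofReal_pow (Real.exp_pos _).le, ← Real.exp_nat_mul]
          push_cast
          rw [sq]
  have hsub : {S : Sample X m | (m : ℝ) ^ 2 * a + L < ∑ i : Fin m, ∑ j : Fin m, ψ (S.2 (i, j))} ⊆
      {S | ENNReal.ofReal (Real.exp ((m : ℝ) ^ 2 * a + L)) ≤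
        ENNReal.ofReal (Real.exp (∑ i : Fin m, ∑ j : Fin m, ψ (S.2 (i, j))))} := by
    intro S hS
    simp only [mem_ofPred_eq] at hS ⊢
    gcongr
  refine (measure_mono hsub).trans ?_
  refine (meas_ge_le_lintegral_div (by fun_prop) (by positivity) (by simp)).trans ?_
  refine (ENNReal.div_le_div_right hint _).trans_eq ?_
  rw [← ENNReal.ofReal_div_of_pos (Real.exp_pos _), ← Real.exp_sub]
  congr 2
  ring

/-- Bernstein's estimate, from `exp u ≤ 1 + u + u²` for `|u| ≤ 1` and `1 + x ≤ exp x`. -/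
theorem lintegral_exp_mul_le {Ω : Type*} [MeasurableSpace Ω] (P : Measure Ω)
    [IsProbabilityMeasure P] (Z : Ω → ℝ) (hZ : Measurable Z) (b τ : ℝ)
    (hb : ∀ ω, |Z ω| ≤ b) (hτ : 0 ≤ τ) (hτb : τ * b ≤ 1) :
    ∫⁻ ω, ENNReal.ofReal (Real.exp (τ * Z ω)) ∂P ≤
      ENNReal.ofReal (Real.exp (τ * ∫ ω, Z ω ∂P + τ ^ 2 * ∫ ω, Z ω ^ 2 ∂P)) := by
  have i1 : Integrable Z P := Integrable.of_bound hZ.aestronglyMeasurable b (.of_forall hb)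
  have i2 : Integrable (fun ω => Z ω ^ 2) P :=
    Integrable.of_bound (by fun_prop) (b ^ 2) (.of_forall fun ω => by
      rw [Real.norm_eq_abs, abs_pow]
      exact pow_le_pow_left₀ (abs_nonneg _) (hb ω) 2)
  have hpt : ∀ ω, Real.exp (τ * Z ω) ≤ 1 + τ * Z ω + τ ^ 2 * Z ω ^ 2 := by
    intro ω
    have h1 : |τ * Z ω| ≤ 1 := by
      rw [abs_mul, abs_of_nonneg hτ]
      exact (mul_le_mul_of_nonneg_left (hb ω) hτ).trans hτb
    have := (abs_le.1 (Real.abs_exp_sub_one_sub_id_le h1)).2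
    nlinarith
  have i3 : Integrable (fun ω => 1 + τ * Z ω + τ ^ 2 * Z ω ^ 2) P :=
    ((integrable_const 1).add (i1.const_mul τ)).add (i2.const_mul _)
  calc _ ≤ ∫⁻ ω, ENNReal.ofReal (1 + τ * Z ω + τ ^ 2 * Z ω ^ 2) ∂P :=
        lintegral_mono fun ω => ENNReal.ofReal_le_ofReal (hpt ω)
    _ = ENNReal.ofReal (∫ ω, (1 + τ * Z ω + τ ^ 2 * Z ω ^ 2) ∂P) :=
        (ofReal_integral_eq_lintegral_ofReal i3
          (.of_forall fun ω => (Real.exp_pos _).le.trans (hpt ω))).symm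
    _ ≤ _ := by
        apply ENNReal.ofReal_le_ofReal
        rw [integral_add (by fun_prop) (by fun_prop), integral_add (by fun_prop) (by fun_prop),
          integral_const_mul, integral_const_mul]
        simp only [integral_const, probReal_univ, one_smul]
        have := Real.add_one_le_exp (τ * ∫ ω, Z ω ∂P + τ ^ 2 * ∫ ω, Z ω ^ 2 ∂P)
        linarith

end Concentration

/-! ### Medians and the pointwise calibration inequality. -/

section Median

/-- If `k < t`, two disjoint half-lines of mass at least `1 / 2` would be separated by an interval
of positive mass. With its mirror image this makes the median unique. -/
theorem le_of_half_le_measure_Iic {μ : Measure ℝ} [IsProbabilityMeasure μ] {t k : ℝ}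
    (ht : IsMedian μ t) (hpos : ∀ u > 0, 0 < μ (Ioo (t - u) t)) (hk : 1 / 2 ≤ μ (Iic k)) :
    t ≤ k := by
  by_contra! h
  have h1 := hpos (t - k) (by linarith)
  rw [sub_sub_cancel] at h1
  have h2 : μ (Iic k) + μ (Ioo k t) + μ (Ici t) ≤ 1 := by
    rw [← measure_union _ measurableSet_Ioo, ← measure_union _ measurableSet_Ici]
    · exact prob_le_one
    · rw [Set.disjoint_left]; rintro x (hx | hx) hx'
      · exact absurd (le_trans hx' hx) (not_le.2 h)
      · exact absurd hx' (not_le.2 hx.2)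
    · rw [Set.disjoint_left]; intro x hx hx'
      exact absurd hx (not_le.2 hx'.1)
  have h3 : (1 : ℝ≥0∞) + μ (Ioo k t) ≤ 1 := by
    calc (1 : ℝ≥0∞) + μ (Ioo k t) = 1 / 2 + μ (Ioo k t) + 1 / 2 := by
          rw [add_right_comm, ENNReal.add_halves]
      _ ≤ μ (Iic k) + μ (Ioo k t) + μ (Ici t) := by gcongr; exact ht.2
      _ ≤ 1 := h2
  have h4 : (1 : ℝ≥0∞) < 1 + μ (Ioo k t) := ENNReal.lt_add_right (by simp) h1.ne'
  exact absurd h3 (not_le.2 h4)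

theorem ge_of_half_le_measure_Ici {μ : Measure ℝ} [IsProbabilityMeasure μ] {t k : ℝ}
    (ht : IsMedian μ t) (hpos : ∀ u > 0, 0 < μ (Ioo t (t + u))) (hk : 1 / 2 ≤ μ (Ici k)) :
    k ≤ t := by
  by_contra! h
  have h1 := hpos (k - t) (by linarith)
  rw [add_sub_cancel] at h1
  have h2 : μ (Iic t) + μ (Ioo t k) + μ (Ici k) ≤ 1 := by
    rw [← measure_union _ measurableSet_Ioo, ← measure_union _ measurableSet_Ici]
    · exact prob_le_one
    · rw [Set.disjoint_left]; rintro x (hx | hx) hx'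
      · exact absurd (le_trans hx' hx) (not_le.2 h)
      · exact absurd hx' (not_le.2 hx.2)
    · rw [Set.disjoint_left]; intro x hx hx'
      exact absurd hx (not_le.2 hx'.1)
  have h3 : (1 : ℝ≥0∞) + μ (Ioo t k) ≤ 1 := by
    calc (1 : ℝ≥0∞) + μ (Ioo t k) = 1 / 2 + μ (Ioo t k) + 1 / 2 := by
          rw [add_right_comm, ENNReal.add_halves]
      _ ≤ μ (Iic t) + μ (Ioo t k) + μ (Ici k) := by gcongr; exact ht.1
      _ ≤ 1 := h2
  have h4 : (1 : ℝ≥0∞) < 1 + μ (Ioo t k) := ENNReal.lt_add_right (by simp) h1.ne'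
  exact absurd h3 (not_le.2 h4)

/-- Markov's inequality: at least half of the mass lies at distance `|t|` or more from zero. -/
theorem abs_median_le {μ : Measure ℝ} {t K : ℝ} (ht : IsMedian μ t) (hK : 0 ≤ K)
    (h : ∫⁻ y, ENNReal.ofReal |y| ∂μ ≤ ENNReal.ofReal K) : |t| ≤ 2 * K := by
  have h1 : (1 / 2 : ℝ≥0∞) ≤ μ {y | ENNReal.ofReal |t| ≤ ENNReal.ofReal |y|} := by
    rcases le_total 0 t with h0 | h0
    · refine ht.2.trans (measure_mono fun y hy => ?_)
      exact ENNReal.ofReal_le_ofReal (abs_le_abs_of_nonneg h0 hy)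
    · refine ht.1.trans (measure_mono fun y hy => ?_)
      exact ENNReal.ofReal_le_ofReal (abs_le_abs_of_nonpos h0 hy)
  have h2 : ENNReal.ofReal |t| * (1 / 2) ≤ ENNReal.ofReal K :=
    (mul_le_mul_right h1 _).trans ((mul_meas_ge_le_lintegral (by fun_prop) _).trans h)
  have h3 : ENNReal.ofReal (|t| * (1 / 2)) ≤ ENNReal.ofReal K := by
    rw [ENNReal.ofReal_mul (abs_nonneg _)]
    convert h2 using 2
    rw [ENNReal.ofReal_div_of_pos (by norm_num)]
    simp
  have h4 := (ENNReal.ofReal_le_ofReal_iff hK).1 h3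
  linarith

theorem abs_abs_sub_sub_abs_sub_le (y x t : ℝ) : |(|y - x| - |y - t|)| ≤ |x - t| := by
  have := abs_abs_sub_abs_le_abs_sub (y - x) (y - t)
  rwa [sub_sub_sub_cancel_left, abs_sub_comm t x] at this

theorem integrable_abs_sub_sub_abs_sub (μ : Measure ℝ) [IsProbabilityMeasure μ] (x t : ℝ) :
    Integrable (fun y => |y - x| - |y - t|) μ :=
  Integrable.of_bound (by fun_prop) |x - t| (.of_forall fun y => abs_abs_sub_sub_abs_sub_le y x t)

/-- `A` is the half-line ending at the median on the side away from `x`, where the loss difference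
is `|x - t|`; elsewhere it is at least `-|x - t|`. Since `A` carries half the mass these
contributions cancel or better, leaving the gain on `I`. -/
theorem mul_measureReal_le_integral_of_median {μ : Measure ℝ} [IsProbabilityMeasure μ]
    {A I : Set ℝ} (hA : MeasurableSet A) (hI : MeasurableSet I) (hA2 : 1 / 2 ≤ μ A) {x t : ℝ}
    (hpt : ∀ y, |x - t| * (2 * A.indicator 1 y - 1) + |x - t| * I.indicator 1 y
      ≤ |y - x| - |y - t|) :
    |x - t| * μ.real I ≤ ∫ y, (|y - x| - |y - t|) ∂μ := by
  have iA : Integrable (A.indicator (1 : ℝ → ℝ)) μ := (integrable_const 1).indicator hA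
  have iI : Integrable (I.indicator (1 : ℝ → ℝ)) μ := (integrable_const 1).indicator hI
  have i1 : Integrable (fun y => |x - t| * (2 * A.indicator 1 y - 1)) μ :=
    ((iA.const_mul 2).sub (integrable_const 1)).const_mul _
  have i2 : Integrable (fun y => |x - t| * I.indicator 1 y) μ := iI.const_mul _
  have h := integral_mono (i1.add i2) (integrable_abs_sub_sub_abs_sub μ x t) hpt
  refine le_trans ?_ h
  have e : ∫ y, ((fun y => |x - t| * (2 * A.indicator 1 y - 1)) + fun y =>
      |x - t| * I.indicator 1 y) y ∂μ = |x - t| * (2 * μ.real A - 1) + |x - t| * μ.real I := by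
    rw [integral_add' i1 i2, integral_const_mul, integral_const_mul,
      integral_sub (iA.const_mul 2) (integrable_const 1), integral_const_mul,
      integral_indicator_one hA, integral_indicator_one hI]
    simp
  rw [e]
  have h2 : (1 / 2 : ℝ) ≤ μ.real A := by
    have := ENNReal.toReal_mono (measure_ne_top μ A) hA2
    simpa [Measure.real] using this
  have : 0 ≤ |x - t| * (2 * μ.real A - 1) := mul_nonneg (abs_nonneg _) (by linarith)
  linarith

theorem mul_le_integral_of_median {μ : Measure ℝ} [IsProbabilityMeasure μ] {t x u v : ℝ}
    (ht : IsMedian μ t) (hu : u ≤ |x - t| / 2)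
    (hl : ENNReal.ofReal v ≤ μ (Ioo (t - u) t)) (hr : ENNReal.ofReal v ≤ μ (Ioo t (t + u))) :
    |x - t| * v ≤ ∫ y, (|y - x| - |y - t|) ∂μ := by
  have hv : ∀ s, ENNReal.ofReal v ≤ μ s → v ≤ μ.real s := fun s hs =>
    (ENNReal.ofReal_le_iff_le_toReal (measure_ne_top μ s)).1 hs
  rcases le_total t x with h | h
  · have hd : |x - t| = x - t := abs_of_nonneg (by linarith)
    refine (mul_le_mul_of_nonneg_left (hv _ hr) (abs_nonneg _)).trans ?_
    -- On the interval of length `u ≤ |x - t| / 2` next to `t`, `y` is at least as close to `t` as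
    -- to `x`, so the loss difference is nonnegative there rather than merely at least `-|x - t|`.
    refine mul_measureReal_le_integral_of_median measurableSet_Iic measurableSet_Ioo ht.1
      fun y => ?_
    rw [hd] at hu ⊢
    simp only [indicator_apply, mem_Iic, mem_Ioo, Pi.one_apply]
    rcases abs_cases (y - x) with ⟨h1, h1'⟩ | ⟨h1, h1'⟩ <;>
    rcases abs_cases (y - t) with ⟨h2, h2'⟩ | ⟨h2, h2'⟩ <;> rw [h1, h2] <;> split_ifs <;>
    grind
  · have hd : |x - t| = t - x := by rw [abs_sub_comm]; exact abs_of_nonneg (by linarith)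
    refine (mul_le_mul_of_nonneg_left (hv _ hl) (abs_nonneg _)).trans ?_
    refine mul_measureReal_le_integral_of_median measurableSet_Ici measurableSet_Ioo ht.2
      fun y => ?_
    rw [hd] at hu ⊢
    simp only [indicator_apply, mem_Ici, mem_Ioo, Pi.one_apply]
    rcases abs_cases (y - x) with ⟨h1, h1'⟩ | ⟨h1, h1'⟩ <;>
    rcases abs_cases (y - t) with ⟨h2, h2'⟩ | ⟨h2, h2'⟩ <;> rw [h1, h2] <;> split_ifs <;>
    grind

theorem abs_sub_median_rpow_le {μ : Measure ℝ} [IsProbabilityMeasure μ] {t a b q x B : ℝ}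
    (ht : IsMedian μ t) (ha0 : 0 < a) (ha1 : a ≤ 1) (hb : 0 < b) (hq : 1 < q)
    (h : ∀ u ∈ Icc 0 a, ENNReal.ofReal (b * u ^ (q - 1)) ≤ μ (Ioo (t - u) t) ∧
      ENNReal.ofReal (b * u ^ (q - 1)) ≤ μ (Ioo t (t + u)))
    (hB : 1 ≤ B) (hx : |x - t| ≤ B) :
    |x - t| ^ q ≤ (2 * B) ^ (q - 1) * ((b * a ^ (q - 1))⁻¹ * ∫ y, (|y - x| - |y - t|) ∂μ) := by
  set d := |x - t| with hd
  have hd0 : 0 ≤ d := abs_nonneg _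
  -- The radius `u = a d / (2B)` is admissible for the noise condition because `d ≤ B`, and is at
  -- most `d / 2` because `a ≤ 1 ≤ B`; being linear in `d`, it yields the power `d ^ q`.
  have h1 : a * d / (2 * B) ≤ a := by
    rw [div_le_iff₀ (by linarith)]; nlinarith
  have h2 : a * d / (2 * B) ≤ d / 2 := by
    rw [div_le_div_iff₀ (by linarith) (by norm_num)]; nlinarith [mul_nonneg hd0 (sub_nonneg.2 hB),
      mul_nonneg hd0 (sub_nonneg.2 ha1)]
  have h0 : 0 ≤ a * d / (2 * B) := by positivity
  obtain ⟨hl, hr⟩ := h _ ⟨h0, h1⟩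
  have key := mul_le_integral_of_median ht h2 hl hr
  rw [← hd] at key
  have e : d * (b * (a * d / (2 * B)) ^ (q - 1)) =
      (b * a ^ (q - 1)) * (d ^ q / (2 * B) ^ (q - 1)) := by
    rw [Real.div_rpow (by positivity) (by positivity), Real.mul_rpow ha0.le hd0]
    rcases hd0.eq_or_lt with h3 | h3
    · rw [← h3, Real.zero_rpow (by linarith [hq] : (0:ℝ) < q).ne']; simp
    · rw [Real.rpow_sub_one h3.ne' q]; field_simp
  rw [e] at key
  have hc : 0 < b * a ^ (q - 1) := by positivity
  have hB' : 0 < (2 * B) ^ (q - 1) := by positivity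
  have h4 : d ^ q / (2 * B) ^ (q - 1) ≤
      (b * a ^ (q - 1))⁻¹ * ∫ y, (|y - x| - |y - t|) ∂μ := by
    rw [inv_mul_eq_div, le_div_iff₀ hc, mul_comm]; exact key
  rwa [div_le_iff₀' hB'] at h4

end Median

/-! ### Excess risk, variance bound and `L^{p*}` calibration. -/

section Excess

variable {X : Type*} [MeasurableSpace X]

/-- The excess risk of `g` relative to `ks`, as the integral of the difference of the losses. -/
noncomputable def excess (ρX : Measure X) (ρc : Kernel (X × X) ℝ) (ks g : X × X → ℝ) : ℝ :=
  ∫ w, (|w.2 - g w.1| - |w.2 - ks w.1|) ∂((ρX.prod ρX) ⊗ₘ ρc)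

/-- Uniqueness of the median identifies each sublevel set with a condition on `ρc z (Iic c)`, which
is measurable in `z`. -/
theorem measurable_median {ρc : Kernel (X × X) ℝ} [IsMarkovKernel ρc] {ks : X × X → ℝ}
    (hmed : ∀ z, IsMedian (ρc z) (ks z))
    (hpos : ∀ z, ∀ u > 0, 0 < ρc z (Ioo (ks z - u) (ks z))) : Measurable ks := by
  refine measurable_of_Iic fun c => ?_
  have : ks ⁻¹' Iic c = {z | 1 / 2 ≤ ρc z (Iic c)} := by
    ext z
    refine ⟨fun h => (hmed z).1.trans (measure_mono (Iic_subset_Iic.2 h)), fun h => ?_⟩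
    exact le_of_half_le_measure_Iic (hmed z) (hpos z) h
  rw [this]
  exact measurableSet_le measurable_const (Kernel.measurable_coe ρc measurableSet_Iic)

variable (ρX : Measure X) [IsProbabilityMeasure ρX] (ρc : Kernel (X × X) ℝ) [IsMarkovKernel ρc]

theorem integrable_loss_sub {ks : X × X → ℝ} (hks : Measurable ks) {g : X × X → ℝ} (hg : Measurable g) {b : ℝ}
    (hb : ∀ z, |g z - ks z| ≤ b) :
    Integrable (fun w => |w.2 - g w.1| - |w.2 - ks w.1|) ((ρX.prod ρX) ⊗ₘ ρc) :=
  Integrable.of_bound (by fun_prop) b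
    (.of_forall fun w => (abs_abs_sub_sub_abs_sub_le w.2 _ _).trans (hb _))

theorem integral_loss_sub_sq_le {ks : X × X → ℝ} (hks : Measurable ks) {g : X × X → ℝ} (hg : Measurable g) {b : ℝ}
    (hb : ∀ z, |g z - ks z| ≤ b) :
    ∫ w, (|w.2 - g w.1| - |w.2 - ks w.1|) ^ 2 ∂((ρX.prod ρX) ⊗ₘ ρc)
      ≤ ∫ z, (g z - ks z) ^ 2 ∂(ρX.prod ρX) := by
  have hpt : ∀ w : (X × X) × ℝ,
      (|w.2 - g w.1| - |w.2 - ks w.1|) ^ 2 ≤ (g w.1 - ks w.1) ^ 2 := fun w => by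
    rw [sq_le_sq]; exact abs_abs_sub_sub_abs_sub_le w.2 _ _
  have hb2 : ∀ z, |(g z - ks z) ^ 2| ≤ b ^ 2 := fun z => by
    rw [abs_pow]; exact pow_le_pow_left₀ (abs_nonneg _) (hb z) 2
  have i2 : Integrable (fun w : (X × X) × ℝ => (g w.1 - ks w.1) ^ 2) ((ρX.prod ρX) ⊗ₘ ρc) :=
    Integrable.of_bound (by fun_prop) (b ^ 2) (.of_forall fun w => hb2 _)
  have i1 : Integrable (fun w : (X × X) × ℝ => (|w.2 - g w.1| - |w.2 - ks w.1|) ^ 2)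
      ((ρX.prod ρX) ⊗ₘ ρc) :=
    i2.mono' (by fun_prop) (.of_forall fun w => by
      rw [Real.norm_of_nonneg (sq_nonneg _)]; exact hpt w)
  refine (integral_mono i1 i2 hpt).trans_eq ?_
  rw [Measure.integral_compProd i2]
  simp

instance (p : ℝ≥0∞) : ENNReal.HolderTriple p 1 (pRatio p) :=
  ⟨by rw [pRatio, inv_inv, inv_one, add_comm]⟩

theorem pRatio_le_one (p : ℝ≥0∞) : pRatio p ≤ 1 := by
  rw [pRatio, ENNReal.inv_le_one]; exact le_self_add

theorem pRatio_ne_top (p : ℝ≥0∞) : pRatio p ≠ ∞ := ((pRatio_le_one p).trans_lt (by simp)).ne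

theorem pRatio_toReal_pos {p : ℝ≥0∞} (hp : 0 < p) : 0 < (pRatio p).toReal := by
  refine ENNReal.toReal_pos ?_ (pRatio_ne_top p)
  simp [pRatio, hp.ne']

theorem theta_pos {p : ℝ≥0∞} (hp : 0 < p) {q : ℝ} (hq : 1 < q) : 0 < theta p q :=
  lt_min (by positivity) (pRatio_toReal_pos hp)

theorem theta_le_one (p : ℝ≥0∞) (q : ℝ) : theta p q ≤ 1 :=
  (min_le_right _ _).trans (ENNReal.toReal_mono (by simp) (pRatio_le_one p))

/-- Integrates the calibration inequality by Hölder with exponents `p` for the weight and `1` for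
the conditional excess, whose `L¹` norm is the excess risk. The dependence on `b` is explicit
because `b` will grow with `m`. -/
theorem exists_eLpNorm_sub_le_excess {ks : X × X → ℝ} (hks : Measurable ks) (p : ℝ≥0∞) {q : ℝ} (hq : 1 < q) {a c : X × X → ℝ}
    (h : ∀ z, IsMedian (ρc z) (ks z) ∧ 0 < a z ∧ a z ≤ 1 ∧ 0 < c z ∧
      ∀ u ∈ Icc 0 (a z),
        ENNReal.ofReal (c z * u ^ (q - 1)) ≤ ρc z (Ioo (ks z - u) (ks z)) ∧
        ENNReal.ofReal (c z * u ^ (q - 1)) ≤ ρc z (Ioo (ks z) (ks z + u)))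
    (hL : MemLp (fun z => (c z * a z ^ (q - 1))⁻¹) p (ρX.prod ρX)) :
    ∃ K : ℝ, 0 ≤ K ∧ ∀ b : ℝ, 1 ≤ b → ∀ g : X × X → ℝ, Measurable g →
      (∀ z, |g z - ks z| ≤ b) → 0 ≤ excess ρX ρc ks g ∧
      eLpNorm (fun z => g z - ks z) (pStar p q) (ρX.prod ρX) ≤
        ENNReal.ofReal ((K * b ^ (q - 1) * excess ρX ρc ks g) ^ (1 / q)) := by
  set W : X × X → ℝ := fun z => (c z * a z ^ (q - 1))⁻¹ with hW
  have hW0 : ∀ z, 0 < W z := fun z => by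
    have := h z
    have := this.2.1
    have := (h z).2.2.2.1
    simp only [hW]; positivity
  refine ⟨2 ^ (q - 1) * (eLpNorm W p (ρX.prod ρX)).toReal, by positivity, ?_⟩
  intro b hb g hg hgb
  set E : X × X → ℝ := fun z => ∫ y, (|y - g z| - |y - ks z|) ∂(ρc z) with hE
  have hcal : ∀ z, |g z - ks z| ^ q ≤ (2 * b) ^ (q - 1) * (W z * E z) := fun z => by
    obtain ⟨h1, h2, h3, h4, h5⟩ := h z
    exact abs_sub_median_rpow_le h1 h2 h3 h4 hq h5 hb (hgb z)
  have hE0 : ∀ z, 0 ≤ E z := fun z => by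
    have h1 : 0 ≤ (2 * b) ^ (q - 1) * (W z * E z) :=
      (Real.rpow_nonneg (abs_nonneg _) q).trans (hcal z)
    have h2 : 0 ≤ W z * E z := nonneg_of_mul_nonneg_right h1 (by positivity)
    exact nonneg_of_mul_nonneg_right h2 (hW0 z)
  have hint := integrable_loss_sub ρX ρc hks hg hgb
  have hΔ : excess ρX ρc ks g = ∫ z, E z ∂(ρX.prod ρX) := Measure.integral_compProd hint
  have hEm : StronglyMeasurable E := by
    have : Measurable fun w : (X × X) × ℝ => |w.2 - g w.1| - |w.2 - ks w.1| := by fun_prop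
    exact StronglyMeasurable.integral_kernel_prod_right' (κ := ρc) this.stronglyMeasurable
  have hEi : Integrable E (ρX.prod ρX) := by
    refine Integrable.of_bound hEm.aestronglyMeasurable b (.of_forall fun z => ?_)
    refine (norm_integral_le_of_norm_le_const (C := b) (.of_forall fun y => ?_)).trans_eq (by simp)
    exact (abs_abs_sub_sub_abs_sub_le y _ _).trans (hgb z)
  have hΔ0 : 0 ≤ excess ρX ρc ks g := hΔ ▸ integral_nonneg hE0
  refine ⟨hΔ0, ?_⟩
  have hq0 : 0 < q := by linarith
  have e1 : eLpNorm E 1 (ρX.prod ρX) = ENNReal.ofReal (excess ρX ρc ks g) := by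
    rw [eLpNorm_one_eq_lintegral_enorm, ← ofReal_integral_norm_eq_lintegral_enorm hEi, hΔ]
    congr 1
    exact integral_congr_ae (.of_forall fun z => Real.norm_of_nonneg (hE0 z))
  have e2 : eLpNorm (fun z => g z - ks z) (pStar p q) (ρX.prod ρX) ^ q ≤
      ENNReal.ofReal (2 ^ (q - 1) * (eLpNorm W p (ρX.prod ρX)).toReal * b ^ (q - 1) *
        excess ρX ρc ks g) := by
    rw [pStar, ← eLpNorm_norm_rpow _ hq0]
    calc _ ≤ eLpNorm ((2 * b) ^ (q - 1) • (W • E)) (pRatio p) (ρX.prod ρX) := by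
          refine eLpNorm_mono fun z => ?_
          rw [Real.norm_of_nonneg (by positivity)]
          exact (hcal z).trans (le_abs_self _)
      _ ≤ ENNReal.ofReal ((2 * b) ^ (q - 1)) * (eLpNorm W p (ρX.prod ρX) *
          eLpNorm E 1 (ρX.prod ρX)) := by
          rw [eLpNorm_const_smul, Real.enorm_of_nonneg (by positivity)]
          gcongr
          exact eLpNorm_smul_le_mul_eLpNorm hEm.aestronglyMeasurable hL.1
      _ = _ := by
          rw [e1, ← ENNReal.ofReal_toReal hL.2.ne, ← ENNReal.ofReal_mul (by positivity),
            ← ENNReal.ofReal_mul (by positivity), Real.mul_rpow (by norm_num) (by linarith)]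
          congr 1
          rw [ENNReal.toReal_ofReal (by positivity)]
          ring
  rw [← ENNReal.ofReal_rpow_of_nonneg (by positivity) (by positivity), one_div]
  exact (ENNReal.le_rpow_inv_iff hq0).2 e2

theorem integral_sq_le_of_eLpNorm_le {p : ℝ≥0∞} (hp : 0 < p) {q : ℝ} (hq : 1 < q)
    {D : X × X → ℝ} (hD : Measurable D) {b T : ℝ} (hT : 0 ≤ T) (hb : 1 ≤ b)
    (hDb : ∀ z, |D z| ≤ b)
    (h : eLpNorm D (pStar p q) (ρX.prod ρX) ≤ ENNReal.ofReal ((b ^ (q - 1) * T) ^ (1 / q))) :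
    ∫ z, D z ^ 2 ∂(ρX.prod ρX) ≤ b ^ (2 - theta p q) * T ^ theta p q := by
  have hq0 : 0 < q := by linarith
  have hb0 : 0 < b := by linarith
  have hS : 0 ≤ b ^ (q - 1) * T := by positivity
  set r := (pRatio p).toReal with hr
  have hr0 : 0 < r := pRatio_toReal_pos hp
  have hps : pStar p q = ENNReal.ofReal (r * q) := by
    rw [pStar, ENNReal.ofReal_mul hr0.le, hr, ENNReal.ofReal_toReal (pRatio_ne_top p)]
  have hmom : ∀ P : ℝ, 0 < P → eLpNorm D (ENNReal.ofReal P) (ρX.prod ρX) ≤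
      ENNReal.ofReal ((b ^ (q - 1) * T) ^ (1 / q)) →
      ∫ z, |D z| ^ P ∂(ρX.prod ρX) ≤ (b ^ (q - 1) * T) ^ (P / q) := by
    intro P hP h1
    have i1 : Integrable (fun z => |D z| ^ P) (ρX.prod ρX) :=
      Integrable.of_bound (hD.norm.pow_const P).aestronglyMeasurable (b ^ P) (.of_forall fun z => by
        rw [Real.norm_of_nonneg (by positivity)]
        exact Real.rpow_le_rpow (abs_nonneg _) (hDb z) hP.le)
    rw [← ENNReal.ofReal_le_ofReal_iff (by positivity),
      ofReal_integral_eq_lintegral_ofReal i1 (.of_forall fun z => by positivity)]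
    have h2 : ∫⁻ z, ENNReal.ofReal (|D z| ^ P) ∂(ρX.prod ρX) =
        eLpNorm D (ENNReal.ofReal P) (ρX.prod ρX) ^ P := by
      rw [eLpNorm_eq_lintegral_rpow_enorm_toReal (by simpa using hP) (by simp),
        ENNReal.toReal_ofReal hP.le, ← ENNReal.rpow_mul, one_div, inv_mul_cancel₀ hP.ne',
        ENNReal.rpow_one]
      refine lintegral_congr fun z => ?_
      rw [← ENNReal.ofReal_rpow_of_nonneg (abs_nonneg _) hP.le, Real.enorm_eq_ofReal_abs]
    rw [h2]
    refine (ENNReal.rpow_le_rpow h1 hP.le).trans_eq ?_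
    rw [ENNReal.ofReal_rpow_of_nonneg (by positivity) hP.le, ← Real.rpow_mul hS]
    congr 2; ring
  -- If `θ = 2 / q` then `p* ≥ 2` and the `L²` norm is dominated by the `L^{p*}` norm. Otherwise `p*
  -- ≤ 2`, and the missing power `2 - p*` is paid with the sup bound. Both cases give exactly `b ^
  -- (2 - θ)`.
  rcases le_total (2 / q) r with hc | hc
  · have hθ : theta p q = 2 / q := min_eq_left hc
    have h2 : ENNReal.ofReal 2 ≤ pStar p q := by
      rw [hps]; apply ENNReal.ofReal_le_ofReal; rwa [div_le_iff₀ hq0] at hc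
    have h3 := hmom 2 (by norm_num)
      ((eLpNorm_le_eLpNorm_of_exponent_le h2 hD.aestronglyMeasurable).trans h)
    rw [hθ]
    have e : ∀ z, |D z| ^ (2 : ℝ) = D z ^ 2 := fun z => by
      rw [Real.rpow_two, sq_abs]
    simp_rw [e] at h3
    refine h3.trans_eq ?_
    rw [Real.mul_rpow (by positivity) hT, ← Real.rpow_mul hb0.le]
    congr 2; field_simp
  · have hθ : theta p q = r := min_eq_right hc
    have hP2 : r * q ≤ 2 := by rwa [le_div_iff₀ hq0] at hc
    have h3 := hmom (r * q) (by positivity) (hps ▸ h)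
    rw [hθ]
    have hpt : ∀ z, D z ^ 2 ≤ b ^ (2 - r * q) * |D z| ^ (r * q) := fun z => by
      rcases (abs_nonneg (D z)).eq_or_lt with h0 | h0
      · rw [← sq_abs, ← h0, zero_pow two_ne_zero]; positivity
      · have e : D z ^ 2 = |D z| ^ (2 - r * q) * |D z| ^ (r * q) := by
          rw [← Real.rpow_add h0, sub_add_cancel, Real.rpow_two, sq_abs]
        rw [e]
        exact mul_le_mul_of_nonneg_right
          (Real.rpow_le_rpow h0.le (hDb z) (by linarith)) (by positivity)
    have i1 : Integrable (fun z => b ^ (2 - r * q) * |D z| ^ (r * q)) (ρX.prod ρX) := by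
      refine Integrable.const_mul ?_ _
      exact Integrable.of_bound (hD.norm.pow_const _).aestronglyMeasurable (b ^ (r * q)) (.of_forall fun z => by
        rw [Real.norm_of_nonneg (by positivity)]
        exact Real.rpow_le_rpow (abs_nonneg _) (hDb z) (by positivity))
    have i2 : Integrable (fun z => D z ^ 2) (ρX.prod ρX) :=
      i1.mono' (by fun_prop) (.of_forall fun z => by
        rw [Real.norm_of_nonneg (sq_nonneg _)]; exact hpt z)
    refine (integral_mono i2 i1 hpt).trans ?_
    rw [integral_const_mul]
    refine (mul_le_mul_of_nonneg_left h3 (by positivity)).trans_eq ?_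
    rw [mul_div_cancel_right₀ _ hq0.ne', Real.mul_rpow (by positivity) hT, ← Real.rpow_mul hb0.le,
      ← mul_assoc, ← Real.rpow_add hb0]
    congr 2; ring

/-- The target function is measurable, the excess risk is nonnegative and controls both the
`L²` norm and the `L^{p*}` norm of the error of uniformly bounded functions. -/
theorem excess_bounds_of_averageType {p : ℝ≥0∞} (hp : 0 < p) {q : ℝ} (hq : 1 < q)
    {ks : X × X → ℝ} (hmed : ∀ z, IsMedian (ρc z) (ks z))
    (hnoise : HasMedianOfAverageType ρX ρc p q) :
    Measurable ks ∧ ∃ K : ℝ, 1 ≤ K ∧ ∀ b : ℝ, 1 ≤ b → ∀ g : X × X → ℝ, Measurable g →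
      (∀ z, |g z - ks z| ≤ b) → 0 ≤ excess ρX ρc ks g ∧
      ∫ z, (g z - ks z) ^ 2 ∂(ρX.prod ρX) ≤
        K * b ^ (2 - theta p q) * excess ρX ρc ks g ^ theta p q ∧
      eLpNorm (fun z => g z - ks z) (pStar p q) (ρX.prod ρX) ≤
        ENNReal.ofReal ((K * b ^ (q - 1) * excess ρX ρc ks g) ^ (1 / q)) := by
  obtain ⟨t, a, c, h, hL⟩ := hnoise
  have hposl : ∀ z, ∀ u > 0, 0 < ρc z (Ioo (t z - u) (t z)) := fun z u hu => by
    obtain ⟨h1, h2, h3, h4, h5⟩ := h z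
    have hu' : 0 < min u (a z) := lt_min hu h2
    refine lt_of_lt_of_le ?_ ((h5 (min u (a z)) ⟨hu'.le, min_le_right _ _⟩).1.trans
      (measure_mono (Ioo_subset_Ioo_left (by linarith [min_le_left u (a z)]))))
    rw [ENNReal.ofReal_pos]; positivity
  have hposr : ∀ z, ∀ u > 0, 0 < ρc z (Ioo (t z) (t z + u)) := fun z u hu => by
    obtain ⟨h1, h2, h3, h4, h5⟩ := h z
    have hu' : 0 < min u (a z) := lt_min hu h2
    refine lt_of_lt_of_le ?_ ((h5 (min u (a z)) ⟨hu'.le, min_le_right _ _⟩).2.trans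
      (measure_mono (Ioo_subset_Ioo_right (by linarith [min_le_left u (a z)]))))
    rw [ENNReal.ofReal_pos]; positivity
  obtain rfl : ks = t := by
    ext z
    exact le_antisymm (ge_of_half_le_measure_Ici (h z).1 (hposr z) (hmed z).2)
      (le_of_half_le_measure_Iic (h z).1 (hposl z) (hmed z).1)
  have hks : Measurable ks := measurable_median hmed hposl
  refine ⟨hks, ?_⟩
  obtain ⟨K, hK0, hK⟩ := exists_eLpNorm_sub_le_excess ρX ρc hks p hq h hL
  -- A constant at least `1` dominates its own power `θ ≤ 1`, so one constant serves both estimates.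
  refine ⟨max K 1, le_max_right _ _, fun b hb g hg hgb => ?_⟩
  obtain ⟨h0, h1⟩ := hK b hb g hg hgb
  have hb0 : 0 < b := by linarith
  have h2 : eLpNorm (fun z => g z - ks z) (pStar p q) (ρX.prod ρX) ≤
      ENNReal.ofReal ((max K 1 * b ^ (q - 1) * excess ρX ρc ks g) ^ (1 / q)) := by
    refine h1.trans (ENNReal.ofReal_le_ofReal ?_)
    gcongr
    exact le_max_left _ _
  refine ⟨h0, ?_, h2⟩
  have h3 := integral_sq_le_of_eLpNorm_le ρX hp hq (hg.sub hks)
    (T := max K 1 * excess ρX ρc ks g) (by positivity) hb hgb (by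
      refine h2.trans_eq ?_
      congr 2; ring)
  refine h3.trans ?_
  have hθ0 := theta_pos hp hq
  have hθ1 := theta_le_one p q
  rw [Real.mul_rpow (by positivity) h0, mul_comm (max K 1), mul_assoc]
  gcongr
  nth_rewrite 2 [← Real.rpow_one (max K 1)]
  exact Real.rpow_le_rpow_of_exponent_le (le_max_right _ _) hθ1

end Excess

/-! ### Existence and uniqueness of the regularized minimizer. -/

section Minimizer

open Filter Topology

/-- Strong midpoint convexity bounds the distance of two near-minimizers by their defects: a
minimizing sequence is Cauchy, and two minimizers coincide. -/
theorem existsUnique_isMinOn_of_midpoint {E : Type*} [NormedAddCommGroup E] [NormedSpace ℝ E]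
    [CompleteSpace E] {Φ : E → ℝ} (hΦ : Continuous Φ) {lam : ℝ} (hlam : 0 < lam)
    (h0 : ∀ f, 0 ≤ Φ f)
    (hmid : ∀ f g, Φ ((1 / 2 : ℝ) • (f + g)) + lam / 4 * ‖f - g‖ ^ 2 ≤ (Φ f + Φ g) / 2) :
    ∃! f, ∀ g, Φ f ≤ Φ g := by
  have hbdd : BddBelow (range Φ) := ⟨0, by rintro _ ⟨f, rfl⟩; exact h0 f⟩
  have hI : ∀ f, ⨅ f, Φ f ≤ Φ f := fun f => ciInf_le hbdd f
  set I := ⨅ f, Φ f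
  have hex : ∀ n : ℕ, ∃ f, Φ f < I + 1 / ((n : ℝ) + 1) := fun n =>
    exists_lt_of_ciInf_lt (lt_add_of_pos_right I (by positivity))
  choose f hf using hex
  have hdist : ∀ n k N : ℕ, N ≤ n → N ≤ k →
      dist (f n) (f k) ≤ Real.sqrt (4 / lam * (1 / ((N : ℝ) + 1))) := by
    intro n k N hn hk
    rw [dist_eq_norm]
    refine Real.le_sqrt_of_sq_le ?_
    have h1 := hmid (f n) (f k)
    have h2 := hI ((1 / 2 : ℝ) • (f n + f k))
    have h3 : 1 / ((n : ℝ) + 1) ≤ 1 / ((N : ℝ) + 1) := by gcongr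
    have h4 : 1 / ((k : ℝ) + 1) ≤ 1 / ((N : ℝ) + 1) := by gcongr
    have h5 : lam / 4 * ‖f n - f k‖ ^ 2 ≤ 1 / ((N : ℝ) + 1) := by linarith [hf n, hf k]
    have h6 : ‖f n - f k‖ ^ 2 = 4 / lam * (lam / 4 * ‖f n - f k‖ ^ 2) := by field_simp
    rw [h6]
    gcongr
  have hlim : Tendsto (fun N : ℕ => Real.sqrt (4 / lam * (1 / ((N : ℝ) + 1)))) atTop (𝓝 0) := by
    have := (tendsto_one_div_add_atTop_nhds_zero_nat (𝕜 := ℝ)).const_mul (4 / lam)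
    simpa using this.sqrt
  obtain ⟨x, hx⟩ := cauchySeq_tendsto_of_complete (cauchySeq_of_le_tendsto_0 _ hdist hlim)
  have hxI : Φ x ≤ I := by
    have h1 : Tendsto (fun n => Φ (f n)) atTop (𝓝 (Φ x)) := (hΦ.tendsto x).comp hx
    have h2 : Tendsto (fun n : ℕ => I + 1 / ((n : ℝ) + 1)) atTop (𝓝 (I + 0)) :=
      tendsto_const_nhds.add tendsto_one_div_add_atTop_nhds_zero_nat
    rw [add_zero] at h2
    exact le_of_tendsto_of_tendsto' h1 h2 fun n => (hf n).le
  refine ⟨x, fun g => hxI.trans (hI g), fun y hy => ?_⟩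
  have h1 := hmid y x
  have h2 := hI ((1 / 2 : ℝ) • (y + x))
  have h3 := hy x
  have h4 : ‖y - x‖ ^ 2 ≤ 0 := by
    by_contra! h
    have : 0 < lam / 4 * ‖y - x‖ ^ 2 := by positivity
    linarith
  have h5 : ‖y - x‖ = 0 := by
    have := sq_nonneg ‖y - x‖
    exact pow_eq_zero_iff two_ne_zero |>.1 (le_antisymm h4 this)
  exact sub_eq_zero.1 (norm_eq_zero.1 h5)

theorem insensitiveLoss_eq_max (ε u : ℝ) : insensitiveLoss ε u = max 0 (|u| - ε) := by
  unfold insensitiveLoss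
  split_ifs with h
  · rw [max_eq_left]; linarith
  · rw [max_eq_right]; linarith

theorem insensitiveLoss_nonneg (ε u : ℝ) : 0 ≤ insensitiveLoss ε u := by
  rw [insensitiveLoss_eq_max]; exact le_max_left _ _

theorem insensitiveLoss_le_abs {ε : ℝ} (hε : 0 ≤ ε) (u : ℝ) : insensitiveLoss ε u ≤ |u| := by
  rw [insensitiveLoss_eq_max]; exact max_le (abs_nonneg _) (by linarith)

theorem abs_le_insensitiveLoss_add (ε u : ℝ) : |u| ≤ insensitiveLoss ε u + ε := by
  rw [insensitiveLoss_eq_max]; linarith [le_max_right 0 (|u| - ε)]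

theorem continuous_insensitiveLoss (ε : ℝ) : Continuous (insensitiveLoss ε) := by
  have : insensitiveLoss ε = fun u => max 0 (|u| - ε) := funext (insensitiveLoss_eq_max ε)
  rw [this]; fun_prop

theorem insensitiveLoss_midpoint (ε u v : ℝ) :
    insensitiveLoss ε ((u + v) / 2) ≤ (insensitiveLoss ε u + insensitiveLoss ε v) / 2 := by
  simp only [insensitiveLoss_eq_max]
  have h : |(u + v) / 2| ≤ (|u| + |v|) / 2 := by
    rw [abs_div, abs_two]; linarith [abs_add_le u v]
  apply max_le
  · linarith [le_max_left 0 (|u| - ε), le_max_left 0 (|v| - ε)]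
  · linarith [le_max_right 0 (|u| - ε), le_max_right 0 (|v| - ε)]

theorem insensitivity_nonneg (γ : ℝ≥0∞) (m : ℕ) : 0 ≤ insensitivity γ m := by
  unfold insensitivity; split_ifs <;> positivity

variable {X : Type*} {H : Type*} [NormedAddCommGroup H]
  [InnerProductSpace ℝ H] [RKHS ℝ H (X × X) ℝ]

theorem existsUnique_isSVRSolution [CompleteSpace H] {m : ℕ} {lam : ℝ} (hlam : 0 < lam) (ε : ℝ)
    (S : Sample X m) : ∃! k : H, IsSVRSolution lam ε S k := by
  refine existsUnique_isMinOn_of_midpoint (Φ := svrObjective (H := H) lam ε S) ?_ hlam ?_ ?_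
  · unfold svrObjective
    have : ∀ z : X × X, Continuous fun f : H => f z := fun z => RKHS.continuous_eval z
    have h2 := continuous_insensitiveLoss ε
    refine ((continuous_finsetSum _ fun i _ => continuous_finsetSum _ fun j _ =>
      h2.comp (continuous_const.sub (this _))).const_mul _).add
      ((continuous_norm.pow 2).const_mul _)
  · intro f
    unfold svrObjective
    have : 0 ≤ ∑ i : Fin m, ∑ j : Fin m, insensitiveLoss ε (S.2 (i, j) - f (S.1 i, S.1 j)) :=
      Finset.sum_nonneg fun i _ => Finset.sum_nonneg fun j _ => insensitiveLoss_nonneg _ _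
    positivity
  · intro f g
    have hpar : ‖(1 / 2 : ℝ) • (f + g)‖ ^ 2 + 1 / 4 * ‖f - g‖ ^ 2 = (‖f‖ ^ 2 + ‖g‖ ^ 2) / 2 := by
      have := parallelogram_law_with_norm ℝ f g
      rw [norm_smul, mul_pow]
      norm_num
      nlinarith
    have hloss : ∑ i : Fin m, ∑ j : Fin m, insensitiveLoss ε
        (S.2 (i, j) - ((1 / 2 : ℝ) • (f + g)) (S.1 i, S.1 j)) ≤
        (∑ i : Fin m, ∑ j : Fin m, insensitiveLoss ε (S.2 (i, j) - f (S.1 i, S.1 j)) +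
        ∑ i : Fin m, ∑ j : Fin m, insensitiveLoss ε (S.2 (i, j) - g (S.1 i, S.1 j))) / 2 := by
      rw [← Finset.sum_add_distrib, Finset.sum_div]
      refine Finset.sum_le_sum fun i _ => ?_
      rw [← Finset.sum_add_distrib, Finset.sum_div]
      refine Finset.sum_le_sum fun j _ => ?_
      refine le_trans (le_of_eq ?_) (insensitiveLoss_midpoint _ _ _)
      congr 1
      simp only [RKHS.coe_smul, RKHS.coe_add, Pi.smul_apply, Pi.add_apply, smul_eq_mul]
      ring
    unfold svrObjective
    have h1 := mul_le_mul_of_nonneg_left hloss (by positivity : 0 ≤ 1 / (m : ℝ) ^ 2)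
    linear_combination h1 + lam * hpar

end Minimizer

/-! ### Continuity, sup bounds and finite nets for balls of `H`. -/

section Capacity

variable {X : Type*} [MetricSpace X]
  {H : Type*} [NormedAddCommGroup H] [InnerProductSpace ℝ H] [CompleteSpace H]
  [RKHS ℝ H (X × X) ℝ]

theorem hyperkernel_eq_inner {X H : Type*} [NormedAddCommGroup H] [InnerProductSpace ℝ H]
    [CompleteSpace H] [RKHS ℝ H (X × X) ℝ] (z w : X × X) :
    hyperkernel H z w = inner ℝ (RKHS.kerFun H w (1 : ℝ)) (RKHS.kerFun H z (1 : ℝ)) := by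
  rw [← RKHS.kernel_inner]
  simp [hyperkernel]

theorem continuous_kerFun_one (hH : IsHyperRKHS (X := X) H) :
    Continuous fun z : X × X => RKHS.kerFun H z (1 : ℝ) := by
  rw [continuous_iff_continuousAt]
  intro z₀
  have hK := hH.continuous_hyperkernel
  rw [ContinuousAt, tendsto_iff_norm_sub_tendsto_zero]
  -- Expanding the square expresses the distance of two kernel sections through the continuous
  -- hyper-kernel.
  have e : ∀ z : X × X, ‖RKHS.kerFun H z (1 : ℝ) - RKHS.kerFun H z₀ (1 : ℝ)‖ =
      Real.sqrt (hyperkernel H z z - 2 * hyperkernel H z₀ z + hyperkernel H z₀ z₀) := fun z => by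
    rw [← Real.sqrt_sq (norm_nonneg _), norm_sub_sq_real]
    simp only [hyperkernel_eq_inner, real_inner_self_eq_norm_sq]
  simp_rw [e]
  generalize (hyperkernel H : X × X → X × X → ℝ) = K at hK
  have hc : Continuous fun z : X × X => Real.sqrt (K z z - 2 * K z₀ z + K z₀ z₀) := by
    fun_prop
  have hlim := hc.tendsto z₀
  have e0 : K z₀ z₀ - 2 * K z₀ z₀ + K z₀ z₀ = 0 := by ring
  rwa [e0, Real.sqrt_zero] at hlim

theorem apply_eq_inner_kerFun_one {X H : Type*} [NormedAddCommGroup H] [InnerProductSpace ℝ H]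
    [CompleteSpace H] [RKHS ℝ H (X × X) ℝ] (k : H) (z : X × X) :
    k z = inner ℝ k (RKHS.kerFun H z (1 : ℝ)) := by
  simp

theorem continuous_of_isHyperRKHS (hH : IsHyperRKHS (X := X) H) (k : H) :
    Continuous (k : X × X → ℝ) := by
  have : (k : X × X → ℝ) = fun z => inner ℝ k (RKHS.kerFun H z (1 : ℝ)) :=
    funext (apply_eq_inner_kerFun_one k)
  rw [this]
  exact continuous_const.inner (continuous_kerFun_one hH)

theorem exists_abs_apply_le [CompactSpace X] (hH : IsHyperRKHS (X := X) H) :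
    ∃ κ : ℝ, 1 ≤ κ ∧ ∀ (k : H) (z : X × X), |k z| ≤ κ * ‖k‖ := by
  obtain ⟨C, hC⟩ := isCompact_univ.exists_bound_of_continuousOn
    (continuous_kerFun_one hH).continuousOn
  refine ⟨max C 1, le_max_right _ _, fun k z => ?_⟩
  rw [apply_eq_inner_kerFun_one]
  refine (abs_real_inner_le_norm _ _).trans ?_
  rw [mul_comm]
  gcongr
  exact (hC z (mem_univ z)).trans (le_max_left _ _)

theorem exists_isCover_encard_eq_externalCoveringNumber {Y : Type*} [PseudoEMetricSpace Y]
    (ε : ℝ≥0) (A : Set Y) :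
    ∃ C : Set Y, Metric.IsCover ε A C ∧ C.encard = Metric.externalCoveringNumber ε A := by
  have : Nonempty {C : Set Y // Metric.IsCover ε A C} := ⟨A, by simp⟩
  obtain ⟨C, hC⟩ := ENat.exists_eq_iInf (fun C : {C : Set Y // Metric.IsCover ε A C} => C.1.encard)
  exact ⟨C.1, C.2, by rw [hC, Metric.externalCoveringNumber, iInf_subtype']⟩

/-- Rescales a cover of the unit ball at radius `t / R`. The centres are only continuous functions,
not elements of `H`, so later deviation bounds must apply to arbitrary measurable functions. -/
theorem exists_finset_cover [CompactSpace X] {s Cs : ℝ}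
    (hC : ∀ η : ℝ≥0, 0 < η →
      ENNReal.log ((Metric.externalCoveringNumber η (hyperBall (X := X) H 1) : ℕ∞) : ℝ≥0∞)
      ≤ ((Cs * (1 / (η : ℝ)) ^ s : ℝ) : EReal)) (hH : IsHyperRKHS (X := X) H)
    {R t : ℝ} (hR : 0 < R) (ht : 0 < t) :
    ∃ N : Finset C(X × X, ℝ), (N.card : ℝ) ≤ Real.exp (Cs * (R / t) ^ s) ∧
      ∀ k : H, ‖k‖ ≤ R → ∃ g ∈ N, ∀ z, |k z - g z| ≤ t := by
  classical
  have hη : 0 < t / R := by positivity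
  have h1 := hC (t / R).toNNReal (Real.toNNReal_pos.2 hη)
  rw [Real.coe_toNNReal _ hη.le, one_div_div] at h1
  obtain ⟨C, hcov, hcard⟩ := exists_isCover_encard_eq_externalCoveringNumber
    (t / R).toNNReal (hyperBall (X := X) H 1)
  rw [← hcard] at h1
  have h2 : ((C.encard : ℕ∞) : ℝ≥0∞) ≤ ENNReal.ofReal (Real.exp (Cs * (R / t) ^ s)) := by
    rw [← ENNReal.log_le_log_iff, ENNReal.log_ofReal_of_pos (Real.exp_pos _), Real.log_exp]
    exact h1
  have hfin : C.Finite := by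
    rw [← Set.encard_ne_top_iff]
    intro h
    rw [h] at h2
    simp at h2
  have h3 : ((hfin.toFinset.card : ℕ) : ℝ) ≤ Real.exp (Cs * (R / t) ^ s) := by
    rw [hfin.encard_eq_coe_toFinset_card] at h2
    have : (((hfin.toFinset.card : ℕ) : ℝ≥0∞)) ≤ ENNReal.ofReal (Real.exp (Cs * (R / t) ^ s)) := by
      simpa using h2
    rw [← ENNReal.ofReal_natCast] at this
    exact (ENNReal.ofReal_le_ofReal_iff (Real.exp_pos _).le).1 this
  refine ⟨hfin.toFinset.image (fun g => R • g), ?_, fun k hk => ?_⟩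
  · exact le_trans (by exact_mod_cast Finset.card_image_le) h3
  · have hmem : (⟨fun z => (R⁻¹ • k) z, continuous_of_isHyperRKHS hH _⟩ : C(X × X, ℝ)) ∈
        hyperBall (X := X) H 1 := by
      refine ⟨R⁻¹ • k, ?_, fun z => rfl⟩
      rw [norm_smul, Real.norm_of_nonneg (by positivity), inv_mul_le_iff₀ hR, mul_one]
      exact hk
    obtain ⟨g, hg, hgd⟩ := hcov hmem
    refine ⟨R • g, Finset.mem_image_of_mem _ (by simpa using hg), fun z => ?_⟩
    have h4 : dist (⟨fun z => (R⁻¹ • k) z, continuous_of_isHyperRKHS hH _⟩ : C(X × X, ℝ)) g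
        ≤ t / R := by
      rw [dist_edist]
      exact ENNReal.toReal_le_of_le_ofReal hη.le hgd
    have h5 := (ContinuousMap.dist_apply_le_dist z).trans h4
    rw [Real.dist_eq] at h5
    have h6 : k z - (R • g) z = R * ((R⁻¹ • k : H) z - g z) := by
      simp only [RKHS.coe_smul, Pi.smul_apply, ContinuousMap.coe_smul, smul_eq_mul]
      field_simp
    rw [h6, abs_mul, abs_of_pos hR]
    calc R * |(R⁻¹ • k : H) z - g z| ≤ R * (t / R) := by gcongr; exact h5
      _ = t := by field_simp

end Capacity

/-! ### Exponential moments of the labels. -/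

section Moments

theorem lintegral_exp_abs_div_le {μ : Measure ℝ} [IsProbabilityMeasure μ] {M c : ℝ} (hM : 0 < M)
    (hc : 0 < c) (h : ∀ ℓ : ℕ, 1 ≤ ℓ →
      ∫⁻ y, ENNReal.ofReal (|y| ^ ℓ) ∂μ ≤ ENNReal.ofReal (c * (ℓ.factorial : ℝ) * M ^ ℓ)) :
    ∫⁻ y, ENNReal.ofReal (Real.exp (|y| / (2 * M))) ∂μ ≤ ENNReal.ofReal (2 * (1 + c)) := by
  have e : ∀ y : ℝ, ENNReal.ofReal (Real.exp (|y| / (2 * M))) =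
      ∑' ℓ : ℕ, ENNReal.ofReal ((|y| / (2 * M)) ^ ℓ / (ℓ.factorial : ℝ)) := fun y => by
    rw [Real.exp_eq_exp_ℝ, NormedSpace.exp_eq_tsum_div]
    exact ENNReal.ofReal_tsum_of_nonneg (fun ℓ => by positivity)
      (Real.summable_pow_div_factorial _)
  simp_rw [e]
  rw [lintegral_tsum (fun ℓ => by fun_prop)]
  -- The factorial cancels and `2M` leaves a geometric series. The term `ℓ = 0`, outside the moment
  -- hypothesis, equals `1`, hence the factor `1 + c`.
  have hterm : ∀ ℓ : ℕ, ∫⁻ y, ENNReal.ofReal ((|y| / (2 * M)) ^ ℓ / (ℓ.factorial : ℝ)) ∂μ ≤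
      ENNReal.ofReal ((1 + c) * (1 / 2) ^ ℓ) := by
    intro ℓ
    rcases Nat.eq_zero_or_pos ℓ with rfl | hℓ
    · simp; linarith
    · have e2 : ∀ y : ℝ, ENNReal.ofReal ((|y| / (2 * M)) ^ ℓ / (ℓ.factorial : ℝ)) =
          ENNReal.ofReal (((2 * M) ^ ℓ * (ℓ.factorial : ℝ))⁻¹) * ENNReal.ofReal (|y| ^ ℓ) :=
        fun y => by
          rw [← ENNReal.ofReal_mul (by positivity), div_pow]
          congr 1; field_simp
      simp_rw [e2]
      rw [lintegral_const_mul _ (by fun_prop)]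
      refine (mul_le_mul_right (h ℓ hℓ) _).trans ?_
      rw [← ENNReal.ofReal_mul (by positivity)]
      apply ENNReal.ofReal_le_ofReal
      have e3 : ((2 * M) ^ ℓ * (ℓ.factorial : ℝ))⁻¹ * (c * (ℓ.factorial : ℝ) * M ^ ℓ) =
          c * (1 / 2) ^ ℓ := by
        rw [mul_pow, one_div, inv_pow]; field_simp
      rw [e3]
      gcongr; linarith
  refine (ENNReal.tsum_le_tsum hterm).trans_eq ?_
  rw [← ENNReal.ofReal_tsum_of_nonneg (fun ℓ => by positivity)
    (summable_geometric_two.mul_left _), tsum_mul_left, tsum_geometric_two]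
  congr 1; ring

/-- The log-moment of the overshoot above `B` decays exponentially in `B`, so a `B` of order `log m`
keeps its sum over `m²` labels bounded. -/
theorem lintegral_exp_posPart_le {μ : Measure ℝ} [IsProbabilityMeasure μ] {M K B : ℝ}
    (hK : 0 ≤ K)
    (h : ∫⁻ y, ENNReal.ofReal (Real.exp (|y| / (2 * M))) ∂μ ≤ ENNReal.ofReal K) :
    ∫⁻ y, ENNReal.ofReal (Real.exp (max 0 (|y| - B) / (2 * M))) ∂μ ≤
      ENNReal.ofReal (Real.exp (K * Real.exp (-(B / (2 * M))))) := by
  have hpt : ∀ y : ℝ, ENNReal.ofReal (Real.exp (max 0 (|y| - B) / (2 * M))) ≤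
      1 + ENNReal.ofReal (Real.exp (-(B / (2 * M)))) *
        ENNReal.ofReal (Real.exp (|y| / (2 * M))) := fun y => by
    rw [← ENNReal.ofReal_one, ← ENNReal.ofReal_mul (Real.exp_pos _).le, ← Real.exp_add,
      ← ENNReal.ofReal_add (by norm_num) (Real.exp_pos _).le]
    apply ENNReal.ofReal_le_ofReal
    rcases max_cases 0 (|y| - B) with ⟨h1, _⟩ | ⟨h1, _⟩ <;> rw [h1]
    · simp [Real.exp_nonneg]
    · rw [show -(B / (2 * M)) + |y| / (2 * M) = (|y| - B) / (2 * M) by ring]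
      linarith
  refine (lintegral_mono hpt).trans ?_
  rw [lintegral_add_left measurable_const, lintegral_const_mul _ (by fun_prop)]
  simp only [lintegral_const, measure_univ, mul_one]
  refine (add_le_add_right (mul_le_mul_right h _) _).trans ?_
  rw [← ENNReal.ofReal_mul (Real.exp_pos _).le, ← ENNReal.ofReal_one,
    ← ENNReal.ofReal_add (by norm_num) (by positivity)]
  apply ENNReal.ofReal_le_ofReal
  have := Real.add_one_le_exp (K * Real.exp (-(B / (2 * M))))
  linarith

end Moments

/-! ### Relative deviation of the empirical excess for one function. -/

section Deviation

variable {X : Type*}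

/-- The empirical excess risk of `g` relative to `ks` over the off-diagonal pairs. -/
noncomputable def empiricalExcess {m : ℕ} (ks g : X × X → ℝ) (S : Sample X m) : ℝ :=
  offDiagMean fun i j =>
    |S.2 (i, j) - g (S.1 i, S.1 j)| - |S.2 (i, j) - ks (S.1 i, S.1 j)|

theorem offDiagMean_const_mul {m : ℕ} (a : ℝ) (g : Fin m → Fin m → ℝ) :
    offDiagMean (fun i j => a * g i j) = a * offDiagMean g := by
  simp only [offDiagMean, ← Finset.mul_sum, mul_div_assoc]

theorem sum_eq_offDiagMean_add {m : ℕ} (hm : 2 ≤ m) (g : Fin m → Fin m → ℝ) :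
    ∑ i, ∑ j, g i j = (m : ℝ) * (m - 1) * offDiagMean g + ∑ i, g i i := by
  have h2 : (2 : ℝ) ≤ m := by exact_mod_cast hm
  have h3 : (m : ℝ) * (m - 1) ≠ 0 := by apply mul_ne_zero <;> linarith
  rw [offDiagMean, mul_div_cancel₀ _ h3, ← Fintype.sum_prod_type' (fun i j => g i j),
    ← Finset.univ_product_univ, ← Finset.diag_union_offDiag,
    Finset.sum_union (Finset.disjoint_diag_offDiag _), add_comm]
  simp

theorem offDiagMean_le_add {m : ℕ} (hm : 2 ≤ m) {g h : Fin m → Fin m → ℝ} {t : ℝ}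
    (hgh : ∀ i j, g i j ≤ h i j + t) : offDiagMean g ≤ offDiagMean h + t := by
  have h2 : (2 : ℝ) ≤ m := by exact_mod_cast hm
  have h3 : 0 < (m : ℝ) * (m - 1) := mul_pos (by linarith) (by linarith)
  have hcard : (((Finset.univ : Finset (Fin m)).offDiag.card : ℕ) : ℝ) = (m : ℝ) * (m - 1) := by
    rw [Finset.offDiag_card, Nat.cast_sub (by simpa using Nat.le_mul_self m)]
    simp; ring
  unfold offDiagMean
  rw [div_le_iff₀ h3, add_mul, div_mul_cancel₀ _ h3.ne']
  refine (Finset.sum_le_sum fun p _ => hgh p.1 p.2).trans_eq ?_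
  rw [Finset.sum_add_distrib, Finset.sum_const, nsmul_eq_mul, hcard, mul_comm t]

theorem abs_abs_sub_sub_le_add {y u v t : ℝ} (h : |u - v| ≤ t) : |y - u| ≤ |y - v| + t := by
  have : |y - u| ≤ |y - v| + |v - u| := abs_sub_le y v u
  rw [abs_sub_comm v u] at this
  linarith

theorem empiricalExcess_le_add {m : ℕ} (hm : 2 ≤ m) (ks : X × X → ℝ) {g h : X × X → ℝ} {t : ℝ}
    (hgh : ∀ z, |g z - h z| ≤ t) (S : Sample X m) :
    empiricalExcess ks g S ≤ empiricalExcess ks h S + t :=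
  offDiagMean_le_add hm fun i j => by
    linarith [abs_abs_sub_sub_le_add (y := S.2 (i, j)) (hgh (S.1 i, S.1 j))]

variable [MeasurableSpace X] (ρX : Measure X) [IsProbabilityMeasure ρX] (ρc : Kernel (X × X) ℝ)
  [IsMarkovKernel ρc]

theorem excess_le_add {ks g h : X × X → ℝ} (hks : Measurable ks) (hg : Measurable g)
    (hh : Measurable h) {b t : ℝ} (hgb : ∀ z, |g z - ks z| ≤ b) (hhb : ∀ z, |h z - ks z| ≤ b)
    (hgh : ∀ z, |g z - h z| ≤ t) : excess ρX ρc ks g ≤ excess ρX ρc ks h + t := by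
  have i1 := integrable_loss_sub ρX ρc hks hg hgb
  have i2 := integrable_loss_sub ρX ρc hks hh hhb
  have e : excess ρX ρc ks h + t =
      ∫ w, ((|w.2 - h w.1| - |w.2 - ks w.1|) + t) ∂((ρX.prod ρX) ⊗ₘ ρc) := by
    rw [integral_add i2 (integrable_const t)]
    simp [excess]
  rw [e]
  refine integral_mono i1 (i2.add (integrable_const t)) fun w => ?_
  have := abs_abs_sub_sub_le_add (y := w.2) (hgh w.1)
  simp only
  linarith

/-- The deviation is measured against `(Δ + t) / 2`, with `Δ` the excess: the variance term is at
most `τ (Δ + t) / 4` because `t^(1-θ) Δ^θ ≤ Δ + t`, so an exponent below `-τ t / 4` per pair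
remains. The sign `σ` covers both tails. -/
theorem sampleLaw_excess_deviation_le {m : ℕ} (hm : 2 ≤ m) {ks g : X × X → ℝ}
    (hks : Measurable ks) (hg : Measurable g) {b V θ t τ σ : ℝ} (hσ : σ = 1 ∨ σ = -1)
    (hb : ∀ z, |g z - ks z| ≤ b) (h0 : 0 ≤ excess ρX ρc ks g)
    (hV : ∫ z, (g z - ks z) ^ 2 ∂(ρX.prod ρX) ≤ V * excess ρX ρc ks g ^ θ)
    (hθ0 : 0 ≤ θ) (hθ1 : θ ≤ 1) (ht : 0 < t) (hτ : 0 ≤ τ) (hτb : τ * b ≤ 1)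
    (hτV : 4 * V * τ ≤ t ^ (1 - θ)) :
    sampleLaw ρX ρc m {S | σ * excess ρX ρc ks g + (excess ρX ρc ks g + t) / 2 <
        σ * empiricalExcess ks g S}
      ≤ ENNReal.ofReal (Real.exp (-((m / 2 : ℕ) * (τ * t / 4)))) := by
  set Δ := excess ρX ρc ks g with hΔ
  have hσ1 : |σ| = 1 := by rcases hσ with rfl | rfl <;> simp
  have hσ2 : σ ^ 2 = 1 := by rcases hσ with rfl | rfl <;> norm_num
  have hmgf := lintegral_exp_mul_le ((ρX.prod ρX) ⊗ₘ ρc)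
    (fun w => σ * (|w.2 - g w.1| - |w.2 - ks w.1|)) (by fun_prop) b τ (fun w => by
      rw [abs_mul, hσ1, one_mul]
      exact (abs_abs_sub_sub_abs_sub_le _ _ _).trans (hb _)) hτ hτb
  have e1 : ∫ w, σ * (|w.2 - g w.1| - |w.2 - ks w.1|) ∂((ρX.prod ρX) ⊗ₘ ρc) = σ * Δ := by
    rw [integral_const_mul]; rfl
  have e2 : ∫ w, (σ * (|w.2 - g w.1| - |w.2 - ks w.1|)) ^ 2 ∂((ρX.prod ρX) ⊗ₘ ρc) ≤ V * Δ ^ θ := by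
    simp_rw [mul_pow, hσ2, one_mul]
    exact (integral_loss_sub_sq_le ρX ρc hks hg hb).trans hV
  rw [e1] at hmgf
  have h := sampleLaw_offDiagMean_gt_le hm ρX ρc
    (fun w => σ * (|w.2 - g w.1| - |w.2 - ks w.1|)) (by fun_prop) τ _
    (σ * Δ + (Δ + t) / 2) hτ hmgf
  simp only [offDiagMean_const_mul] at h
  refine h.trans (ENNReal.ofReal_le_ofReal (Real.exp_le_exp.2 ?_))
  rw [← mul_neg]
  refine mul_le_mul_of_nonneg_left ?_ (Nat.cast_nonneg _)
  have h1 : t ^ (1 - θ) * Δ ^ θ ≤ Δ + t := by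
    calc t ^ (1 - θ) * Δ ^ θ ≤ (Δ + t) ^ (1 - θ) * (Δ + t) ^ θ := by
          gcongr <;> linarith
      _ = Δ + t := by rw [← Real.rpow_add (by linarith)]; simp
  have h2 : τ * (V * Δ ^ θ) ≤ (Δ + t) / 4 := by
    have : 4 * V * τ * Δ ^ θ ≤ t ^ (1 - θ) * Δ ^ θ := by gcongr
    linarith
  have h3 : τ ^ 2 * ∫ w, (σ * (|w.2 - g w.1| - |w.2 - ks w.1|)) ^ 2 ∂((ρX.prod ρX) ⊗ₘ ρc) ≤
      τ * ((Δ + t) / 4) := by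
    rw [sq, mul_assoc]
    exact mul_le_mul_of_nonneg_left ((mul_le_mul_of_nonneg_left e2 hτ).trans h2) hτ
  have h4 : 0 ≤ τ * Δ := mul_nonneg hτ h0
  linarith

end Deviation

/-! ### The projection `π_B`. -/

section Projection

theorem proj_eq {B : ℝ} (hB : 0 ≤ B) (t : ℝ) : proj B t = max (-B) (min t B) := by
  unfold proj
  split_ifs with h1 h2
  · rw [min_eq_right h1.le, max_eq_right (by linarith)]
  · rw [min_eq_left (by linarith), max_eq_left h2.le]
  · rw [min_eq_left (by linarith), max_eq_right (by linarith)]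

theorem abs_proj_le {B : ℝ} (hB : 0 ≤ B) (t : ℝ) : |proj B t| ≤ B := by
  rw [proj_eq hB, abs_le]
  exact ⟨le_max_left _ _, max_le (by linarith) (min_le_right _ _)⟩

theorem abs_proj_sub_proj_le {B : ℝ} (hB : 0 ≤ B) (u v : ℝ) : |proj B u - proj B v| ≤ |u - v| := by
  unfold proj
  rw [abs_le]
  rcases abs_cases (u - v) with ⟨h, _⟩ | ⟨h, _⟩ <;> rw [h] <;> split_ifs <;> constructor <;> linarith

theorem abs_proj_sub_le_of_abs_le {A B u v : ℝ} (hA : 0 ≤ A) (hAB : A ≤ B) (hv : |v| ≤ A) :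
    |proj A u - v| ≤ |proj B u - v| := by
  obtain ⟨h1, h2⟩ := abs_le.1 hv
  unfold proj
  split_ifs <;>
  rcases abs_cases (_ - v : ℝ) with ⟨h, _⟩ | ⟨h, _⟩ <;> rw [h] <;> grind

theorem abs_sub_proj_le (B y t : ℝ) :
    |y - proj B t| ≤ |y - t| + max 0 (|y| - B) := by
  have h1 := le_max_left 0 (|y| - B)
  have h2 := le_max_right 0 (|y| - B)
  have h3 := le_abs_self y
  have h4 := neg_abs_le y
  unfold proj
  split_ifs <;> rw [abs_le] <;> constructor <;>
  rcases abs_cases (y - t) with ⟨h, _⟩ | ⟨h, _⟩ <;> rw [h] <;> linarith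

theorem measurable_proj (B : ℝ) : Measurable (proj B) := by
  unfold proj
  exact Measurable.ite measurableSet_Ioi measurable_const
    (Measurable.ite measurableSet_Iio measurable_const measurable_id)

end Projection

/-! ### Deterministic consequences of minimality. -/

section BasicInequality

variable {X : Type*} {H : Type*} [NormedAddCommGroup H] [InnerProductSpace ℝ H]
  [RKHS ℝ H (X × X) ℝ]

theorem mul_norm_sq_le_of_isSVRSolution {m : ℕ} {lam ε : ℝ} (hε : 0 ≤ ε) {S : Sample X m} {f : H}
    (hf : IsSVRSolution lam ε S f) :
    lam * ‖f‖ ^ 2 ≤ 1 / (m : ℝ) ^ 2 * ∑ i : Fin m, ∑ j : Fin m, |S.2 (i, j)| := by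
  have h := hf 0
  unfold svrObjective at h
  have h1 : 0 ≤ 1 / (m : ℝ) ^ 2 *
      ∑ i : Fin m, ∑ j : Fin m, insensitiveLoss ε (S.2 (i, j) - f (S.1 i, S.1 j)) :=
    mul_nonneg (by positivity)
      (Finset.sum_nonneg fun i _ => Finset.sum_nonneg fun j _ => insensitiveLoss_nonneg _ _)
  have h2 : 1 / (m : ℝ) ^ 2 *
      ∑ i : Fin m, ∑ j : Fin m, insensitiveLoss ε (S.2 (i, j) - (0 : H) (S.1 i, S.1 j)) ≤
      1 / (m : ℝ) ^ 2 * ∑ i : Fin m, ∑ j : Fin m, |S.2 (i, j)| := by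
    gcongr with i _ j _
    refine (insensitiveLoss_le_abs hε _).trans_eq ?_
    simp
  simp only [norm_zero] at h
  linarith

/-- Minimality compares `f` with `k₀`. Passing to the absolute loss costs `ε`, projecting costs the
overshoot of the labels above `B`, and dropping the diagonal costs `(b₁ + b₀) / m`. The factor `2`
comes from `m (m - 1) ≥ m² / 2`. -/
theorem empiricalExcess_proj_le_of_isSVRSolution {m : ℕ} (hm : 2 ≤ m) {lam ε : ℝ}
    (hlam : 0 ≤ lam) (hε : 0 ≤ ε) {S : Sample X m} {f : H} (hf : IsSVRSolution lam ε S f) (k₀ : H)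
    {ks : X × X → ℝ} {B b₁ b₀ : ℝ} (hb₁ : ∀ z, |proj B (f z) - ks z| ≤ b₁)
    (hb₀ : ∀ z, |k₀ z - ks z| ≤ b₀) :
    empiricalExcess ks (fun z => proj B (f z)) S ≤ empiricalExcess ks k₀ S +
      2 * ((b₁ + b₀) / m + lam * ‖k₀‖ ^ 2 + ε +
        1 / (m : ℝ) ^ 2 * ∑ i : Fin m, ∑ j : Fin m, max 0 (|S.2 (i, j)| - B)) := by
  have hm2 : (2 : ℝ) ≤ m := by exact_mod_cast hm
  have hm0 : (0 : ℝ) < m := by linarith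
  set h₁ : Fin m → Fin m → ℝ := fun i j =>
    |S.2 (i, j) - proj B (f (S.1 i, S.1 j))| - |S.2 (i, j) - ks (S.1 i, S.1 j)| with hh₁
  set h₀ : Fin m → Fin m → ℝ := fun i j =>
    |S.2 (i, j) - k₀ (S.1 i, S.1 j)| - |S.2 (i, j) - ks (S.1 i, S.1 j)| with hh₀
  set T := ∑ i : Fin m, ∑ j : Fin m, max 0 (|S.2 (i, j)| - B) with hT
  have hsol := hf k₀
  unfold svrObjective at hsol
  have hpt : ∀ i j, h₁ i j + insensitiveLoss ε (S.2 (i, j) - k₀ (S.1 i, S.1 j)) ≤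
      h₀ i j + insensitiveLoss ε (S.2 (i, j) - f (S.1 i, S.1 j)) + ε +
        max 0 (|S.2 (i, j)| - B) := by
    intro i j
    have e1 := abs_sub_proj_le B (S.2 (i, j)) (f (S.1 i, S.1 j))
    have e2 := abs_le_insensitiveLoss_add ε (S.2 (i, j) - f (S.1 i, S.1 j))
    have e3 := insensitiveLoss_le_abs hε (S.2 (i, j) - k₀ (S.1 i, S.1 j))
    simp only [hh₁, hh₀]
    linarith
  have hsum := Finset.sum_le_sum fun i (_ : i ∈ Finset.univ) =>
    Finset.sum_le_sum fun j (_ : j ∈ Finset.univ) => hpt i j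
  simp only [Finset.sum_add_distrib, Finset.sum_const, Finset.card_univ, Fintype.card_fin,
    nsmul_eq_mul] at hsum
  rw [← hT] at hsum
  have hd₁ : -(m * b₁) ≤ ∑ i, h₁ i i := by
    have : ∑ _i : Fin m, -b₁ ≤ ∑ i, h₁ i i := Finset.sum_le_sum fun i _ =>
      (abs_le.1 ((abs_abs_sub_sub_abs_sub_le _ _ _).trans (hb₁ (S.1 i, S.1 i)))).1
    simpa using this
  have hd₀ : ∑ i, h₀ i i ≤ m * b₀ := by
    have : ∑ i, h₀ i i ≤ ∑ _i : Fin m, b₀ := Finset.sum_le_sum fun i _ =>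
      (abs_le.1 ((abs_abs_sub_sub_abs_sub_le _ _ _).trans (hb₀ (S.1 i, S.1 i)))).2
    simpa using this
  rw [sum_eq_offDiagMean_add hm h₁, sum_eq_offDiagMean_add hm h₀] at hsum
  change offDiagMean h₁ ≤ offDiagMean h₀ + _
  set U₁ := offDiagMean h₁
  set U₀ := offDiagMean h₀
  have hsol' : ∑ i : Fin m, ∑ j : Fin m, insensitiveLoss ε (S.2 (i, j) - f (S.1 i, S.1 j)) -
      ∑ i : Fin m, ∑ j : Fin m, insensitiveLoss ε (S.2 (i, j) - k₀ (S.1 i, S.1 j)) ≤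
      (m : ℝ) ^ 2 * (lam * ‖k₀‖ ^ 2) := by
    have h5 : 0 ≤ lam * ‖f‖ ^ 2 := by positivity
    have h6 := mul_le_mul_of_nonneg_left hsol (by positivity : (0 : ℝ) ≤ (m : ℝ) ^ 2)
    simp only [mul_add, ← mul_assoc, mul_one_div_cancel (pow_ne_zero 2 hm0.ne'), one_mul] at h6
    have h7 : 0 ≤ (m : ℝ) ^ 2 * lam * ‖f‖ ^ 2 := by positivity
    linarith
  have hT0 : 0 ≤ T := Finset.sum_nonneg fun i _ => Finset.sum_nonneg fun j _ => le_max_left _ _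
  have hb₁0 : 0 ≤ b₁ := (abs_nonneg _).trans (hb₁ (S.1 ⟨0, by omega⟩, S.1 ⟨0, by omega⟩))
  have hb₀0 : 0 ≤ b₀ := (abs_nonneg _).trans (hb₀ (S.1 ⟨0, by omega⟩, S.1 ⟨0, by omega⟩))
  set Q := (b₁ + b₀) / m + lam * ‖k₀‖ ^ 2 + ε + 1 / (m : ℝ) ^ 2 * T with hQ
  have hQ0 : 0 ≤ Q := by positivity
  have hmQ : (m : ℝ) ^ 2 * Q = m * (b₁ + b₀) + (m : ℝ) ^ 2 * (lam * ‖k₀‖ ^ 2) + (m : ℝ) ^ 2 * ε + T := by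
    rw [hQ]; field_simp
  have hfin : (m : ℝ) * (m - 1) * (U₁ - U₀) ≤ (m : ℝ) ^ 2 * Q := by
    rw [hmQ]; nlinarith
  by_contra! hcon
  have h8 : 2 * Q < U₁ - U₀ := by linarith
  have h9 : (m : ℝ) ^ 2 * Q ≤ (m : ℝ) * (m - 1) * (2 * Q) := by nlinarith [mul_nonneg hm0.le hQ0]
  have h10 : (m : ℝ) * (m - 1) * (2 * Q) < (m : ℝ) * (m - 1) * (U₁ - U₀) :=
    mul_lt_mul_of_pos_left h8 (mul_pos hm0 (by linarith))
  linarith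

end BasicInequality

/-! ### The oracle inequality outside an exceptional event. -/

/-- Four bad events of probability at most `exp (-L)` each: large mean label (controls `‖f‖`), large
overshoot, a deviation somewhere on the net, and a deviation at `k₀`. The numerical hypotheses are
what a choice of `t`, `R` and step sizes must satisfy. -/
theorem exists_event_excess_le
    {X : Type*} [MetricSpace X] [CompactSpace X] [MeasurableSpace X] [BorelSpace X]
    {H : Type*} [NormedAddCommGroup H] [InnerProductSpace ℝ H] [CompleteSpace H]
    [RKHS ℝ H (X × X) ℝ] (hH : IsHyperRKHS (X := X) H)
    (ρX : Measure X) [IsProbabilityMeasure ρX] (ρc : Kernel (X × X) ℝ) [IsMarkovKernel ρc]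
    {ks : X × X → ℝ} (hks : Measurable ks) {K θ : ℝ} (hθ0 : 0 ≤ θ) (hθ1 : θ ≤ 1)
    (hvar : ∀ b : ℝ, 1 ≤ b → ∀ g : X × X → ℝ, Measurable g → (∀ z, |g z - ks z| ≤ b) →
      0 ≤ excess ρX ρc ks g ∧
      ∫ z, (g z - ks z) ^ 2 ∂(ρX.prod ρX) ≤ K * b ^ (2 - θ) * excess ρX ρc ks g ^ θ)
    {M Kₑ : ℝ} (hM : 0 < M) (hKₑ : 1 ≤ Kₑ)
    (hexp : ∀ z, ∫⁻ y, ENNReal.ofReal (Real.exp (|y| / (2 * M))) ∂(ρc z) ≤ ENNReal.ofReal Kₑ)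
    {s Cs : ℝ}
    (hC : ∀ η : ℝ≥0, 0 < η →
      ENNReal.log ((Metric.externalCoveringNumber η (hyperBall (X := X) H 1) : ℕ∞) : ℝ≥0∞)
      ≤ ((Cs * (1 / (η : ℝ)) ^ s : ℝ) : EReal))
    {m : ℕ} (hm : 2 ≤ m) {lam ε : ℝ} (hlam : 0 < lam) (hε : 0 ≤ ε)
    {B : ℝ} (hB : 1 ≤ B) (hksB : ∀ z, |ks z| ≤ B)
    (hBm : (m : ℝ) ^ 2 * Real.exp (-(B / (2 * M))) ≤ 1)
    (k₀ : H) {b₀ : ℝ} (hb₀ : 1 ≤ b₀) (hk₀ : ∀ z, |k₀ z - ks z| ≤ b₀)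
    {t L R τ₁ τ₀ : ℝ} (ht : 0 < t) (hL : 0 ≤ L) (hR : 0 < R)
    (hRY : 2 * M * (Real.log Kₑ + L) ≤ lam * R ^ 2)
    (hτ₁ : 0 ≤ τ₁) (hτ₁b : τ₁ * (2 * B) ≤ 1) (hτ₁V : 4 * (K * (2 * B) ^ (2 - θ)) * τ₁ ≤ t ^ (1 - θ))
    (hτ₁L : Cs * (R / t) ^ s + L ≤ (m / 2 : ℕ) * (τ₁ * t / 4))
    (hτ₀ : 0 ≤ τ₀) (hτ₀b : τ₀ * b₀ ≤ 1) (hτ₀V : 4 * (K * b₀ ^ (2 - θ)) * τ₀ ≤ t ^ (1 - θ))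
    (hτ₀L : L ≤ (m / 2 : ℕ) * (τ₀ * t / 4)) :
    ∃ E : Set (Sample X m), sampleLaw ρX ρc m E ≤ ENNReal.ofReal (4 * Real.exp (-L)) ∧
      ∀ S, S ∉ E → ∀ f : H, IsSVRSolution lam ε S f →
        excess ρX ρc ks (fun z => proj B (f z)) ≤
          5 * t + 4 * (excess ρX ρc ks k₀ + lam * ‖k₀‖ ^ 2) +
          4 * ((2 * B + b₀) / m + ε + 2 * M * (Kₑ + L) / (m : ℝ) ^ 2) := by
  have hB0 : 0 ≤ B := by linarith
  have hm2 : (2 : ℝ) ≤ m := by exact_mod_cast hm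
  have hm0 : (0 : ℝ) < m := by linarith
  have hcont : ∀ k : H, Measurable (k : X × X → ℝ) := fun k =>
    (continuous_of_isHyperRKHS hH k).measurable
  have hpb : ∀ (g : X × X → ℝ) z, |proj B (g z) - ks z| ≤ 2 * B := fun g z => by
    have h1 := abs_sub (proj B (g z)) (ks z)
    linarith [abs_proj_le hB0 (g z), hksB z]
  obtain ⟨N, hN, hcov⟩ := exists_finset_cover hC hH hR ht
  set E₁ : Set (Sample X m) :=
    {S | (m : ℝ) ^ 2 * Real.log Kₑ + L < ∑ i : Fin m, ∑ j : Fin m, |S.2 (i, j)| / (2 * M)} with hE₁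
  set E₂ : Set (Sample X m) :=
    {S | (m : ℝ) ^ 2 * (Kₑ * Real.exp (-(B / (2 * M)))) + L <
      ∑ i : Fin m, ∑ j : Fin m, max 0 (|S.2 (i, j)| - B) / (2 * M)} with hE₂
  set E₃ : Set (Sample X m) := ⋃ g ∈ N, {S | (-1) * excess ρX ρc ks (fun z => proj B (g z)) +
    (excess ρX ρc ks (fun z => proj B (g z)) + t) / 2 <
      (-1) * empiricalExcess ks (fun z => proj B (g z)) S} with hE₃
  set E₀ : Set (Sample X m) := {S | 1 * excess ρX ρc ks k₀ +
    (excess ρX ρc ks k₀ + t) / 2 < 1 * empiricalExcess ks k₀ S} with hE₀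
  have m₁ : sampleLaw ρX ρc m E₁ ≤ ENNReal.ofReal (Real.exp (-L)) := by
    refine sampleLaw_sum_label_gt_le ρX ρc (fun y => |y| / (2 * M)) (by fun_prop) _ L fun z => ?_
    rw [Real.exp_log (by linarith)]
    exact hexp z
  have m₂ : sampleLaw ρX ρc m E₂ ≤ ENNReal.ofReal (Real.exp (-L)) :=
    sampleLaw_sum_label_gt_le ρX ρc (fun y => max 0 (|y| - B) / (2 * M)) (by fun_prop) _ L
      fun z => lintegral_exp_posPart_le (by linarith) (hexp z)
  have m₀ : sampleLaw ρX ρc m E₀ ≤ ENNReal.ofReal (Real.exp (-L)) := by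
    obtain ⟨h0, h1⟩ := hvar b₀ hb₀ k₀ (hcont k₀) hk₀
    refine (sampleLaw_excess_deviation_le ρX ρc hm hks (hcont k₀) (Or.inl rfl) hk₀ h0 h1 hθ0 hθ1
      ht hτ₀ hτ₀b hτ₀V).trans ?_
    exact ENNReal.ofReal_le_ofReal (Real.exp_le_exp.2 (by linarith))
  have hgm : ∀ g : C(X × X, ℝ), Measurable fun z => proj B (g z) := fun g =>
    (measurable_proj B).comp g.continuous.measurable
  have m₃ : sampleLaw ρX ρc m E₃ ≤ ENNReal.ofReal (Real.exp (-L)) := by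
    refine (measure_biUnion_finset_le N _).trans ?_
    refine (Finset.sum_le_sum (g := fun _ => ENNReal.ofReal
      (Real.exp (-((m / 2 : ℕ) * (τ₁ * t / 4))))) fun g _ => ?_).trans ?_
    · obtain ⟨h0, h1⟩ := hvar (2 * B) (by linarith) _ (hgm g) (hpb g)
      exact sampleLaw_excess_deviation_le ρX ρc hm hks (hgm g) (Or.inr rfl) (hpb g) h0 h1 hθ0 hθ1
        ht hτ₁ hτ₁b hτ₁V
    · rw [Finset.sum_const, nsmul_eq_mul, ← ENNReal.ofReal_natCast,
        ← ENNReal.ofReal_mul (Nat.cast_nonneg _)]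
      apply ENNReal.ofReal_le_ofReal
      refine (mul_le_mul_of_nonneg_right hN (Real.exp_pos _).le).trans ?_
      rw [← Real.exp_add]
      exact Real.exp_le_exp.2 (by linarith)
  refine ⟨E₁ ∪ E₂ ∪ E₃ ∪ E₀, ?_, fun S hS f hf => ?_⟩
  · refine (measure_union_le _ _).trans ((add_le_add ((measure_union_le _ _).trans
      (add_le_add ((measure_union_le _ _).trans (add_le_add m₁ m₂)) m₃)) m₀).trans_eq ?_)
    rw [← ENNReal.ofReal_add (Real.exp_pos _).le (Real.exp_pos _).le,
      ← ENNReal.ofReal_add (by positivity) (Real.exp_pos _).le,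
      ← ENNReal.ofReal_add (by positivity) (Real.exp_pos _).le]
    congr 1; ring
  · simp only [mem_union, not_or] at hS
    obtain ⟨⟨⟨s₁, s₂⟩, s₃⟩, s₀⟩ := hS
    simp only [hE₁, hE₂, hE₀, mem_ofPred_eq, not_lt, ← Finset.sum_div] at s₁ s₂ s₀
    rw [div_le_iff₀ (by linarith)] at s₁ s₂
    have hmm : (1 : ℝ) ≤ (m : ℝ) ^ 2 := by nlinarith
    have hfR : ‖f‖ ≤ R := by
      have h1 := mul_norm_sq_le_of_isSVRSolution hε hf
      have h2 : 1 / (m : ℝ) ^ 2 * ∑ i : Fin m, ∑ j : Fin m, |S.2 (i, j)| ≤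
          2 * M * (Real.log Kₑ + L) := by
        rw [one_div, inv_mul_le_iff₀ (by positivity)]
        refine s₁.trans ?_
        have : L ≤ (m : ℝ) ^ 2 * L := le_mul_of_one_le_left hL hmm
        have := mul_le_mul_of_nonneg_right this (by linarith : 0 ≤ 2 * M)
        linarith
      have h3 : lam * ‖f‖ ^ 2 ≤ lam * R ^ 2 := h1.trans (h2.trans hRY)
      exact le_of_sq_le_sq (le_of_mul_le_mul_left h3 hlam) hR.le
    obtain ⟨g, hgN, hfg⟩ := hcov f hfR
    have s₃' : ¬ (-1) * excess ρX ρc ks (fun z => proj B (g z)) +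
        (excess ρX ρc ks (fun z => proj B (g z)) + t) / 2 <
        (-1) * empiricalExcess ks (fun z => proj B (g z)) S := fun h =>
      s₃ (mem_biUnion (Finset.mem_coe.2 hgN) h)
    have hproj : ∀ z, |proj B (f z) - proj B (g z)| ≤ t := fun z =>
      (abs_proj_sub_proj_le hB0 _ _).trans (hfg z)
    have hfm : Measurable fun z => proj B (f z) := (measurable_proj B).comp (hcont f)
    have d₁ := excess_le_add ρX ρc hks hfm (hgm g) (hpb f) (hpb g) hproj
    have d₂ := empiricalExcess_le_add hm ks (g := fun z => proj B (g z))
      (h := fun z => proj B (f z)) (fun z => by rw [abs_sub_comm]; exact hproj z) S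
    have d₃ := empiricalExcess_proj_le_of_isSVRSolution hm hlam.le hε hf k₀ (hpb f) hk₀
    have hT : 1 / (m : ℝ) ^ 2 * ∑ i : Fin m, ∑ j : Fin m, max 0 (|S.2 (i, j)| - B) ≤
        2 * M * (Kₑ + L) / (m : ℝ) ^ 2 := by
      rw [one_div, inv_mul_eq_div]
      refine div_le_div_of_nonneg_right (s₂.trans ?_) (by positivity)
      have : (m : ℝ) ^ 2 * (Kₑ * Real.exp (-(B / (2 * M)))) ≤ Kₑ := by
        have := mul_le_mul_of_nonneg_left hBm (by linarith : 0 ≤ Kₑ)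
        linarith
      rw [mul_comm]
      exact mul_le_mul_of_nonneg_left (by linarith) (by linarith)
    -- The net bound reads `Δ_g ≤ 2 Δ̂_g + t`, with hats for empirical excess; moving between `f`
    -- and `g` adds `3t`, and `Δ̂_{k₀} ≤ (3 Δ_{k₀} + t) / 2` adds the last `t`. Nonnegativity of
    -- `Δ_{k₀}` allows `3` to be replaced by `4`.
    obtain ⟨h0, -⟩ := hvar b₀ hb₀ k₀ (hcont k₀) hk₀
    linarith

/-! ### Choice of the step size and arithmetic of the exponents. -/

section Exponents

/-- With the largest admissible `τ`, the product `τ t` is the minimum of `t / b` and `(t / b)^(2-θ)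
/ (4K)`; only the ratio `t / b` matters. The constant is `48 = 3 · 4 · 4`, from `m / 2 ≥ m / 3`
after rounding down, the `4K`, and the division by `4` in the deviation exponent. -/
theorem exists_step_size {m : ℕ} (hm : 2 ≤ m) {K b t θ A L ν : ℝ} (hK : 1 ≤ K) (hθ1 : θ ≤ 1)
    (hb : 0 < b) (ht : 0 < t) (hA : 1 ≤ A) (hL : 1 ≤ L) (hν : 0 ≤ ν)
    (htb : A * L * (m : ℝ) ^ (-ν) ≤ t / b) :
    ∃ τ : ℝ, 0 ≤ τ ∧ τ * b ≤ 1 ∧ 4 * (K * b ^ (2 - θ)) * τ ≤ t ^ (1 - θ) ∧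
      A / (48 * K) * L * (m : ℝ) ^ (1 - ν * (2 - θ)) ≤ (m / 2 : ℕ) * (τ * t / 4) := by
  have hm2 : (2 : ℝ) ≤ m := by exact_mod_cast hm
  have hm0 : (0 : ℝ) < m := by linarith
  have hn : (m : ℝ) / 3 ≤ (m / 2 : ℕ) := by
    have : m ≤ 3 * (m / 2) := by omega
    have : (m : ℝ) ≤ 3 * ((m / 2 : ℕ) : ℝ) := by exact_mod_cast this
    linarith
  set W := (m : ℝ) ^ (-(ν * (2 - θ))) with hW
  have hW0 : 0 < W := by positivity
  have hAL : 1 ≤ A * L := one_le_mul_of_one_le_of_one_le hA hL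
  have hu : 0 < t / b := by positivity
  have h1 : A * L * W ≤ t / b := by
    refine le_trans ?_ htb
    refine mul_le_mul_of_nonneg_left ?_ (by positivity)
    exact Real.rpow_le_rpow_of_exponent_le (by linarith) (by nlinarith)
  have h2 : A * L * W ≤ (t / b) ^ (2 - θ) := by
    refine le_trans ?_ (Real.rpow_le_rpow (by positivity) htb (by linarith))
    rw [Real.mul_rpow (by positivity) (by positivity), ← Real.rpow_mul hm0.le,
      show -ν * (2 - θ) = -(ν * (2 - θ)) by ring]
    gcongr
    nth_rewrite 1 [← Real.rpow_one (A * L)]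
    exact Real.rpow_le_rpow_of_exponent_le hAL (by linarith)
  have hV : 0 < 4 * (K * b ^ (2 - θ)) := by positivity
  have hfin : ∀ τ : ℝ, A * L * W / (4 * K) ≤ τ * t →
      A / (48 * K) * L * (m : ℝ) ^ (1 - ν * (2 - θ)) ≤ (m / 2 : ℕ) * (τ * t / 4) := by
    intro τ h
    have e : A / (48 * K) * L * (m : ℝ) ^ (1 - ν * (2 - θ)) =
        (m : ℝ) / 3 * (A * L * W / (4 * K) / 4) := by
      rw [sub_eq_add_neg, Real.rpow_add hm0, Real.rpow_one, hW]
      field_simp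
      norm_num
    rw [e]
    gcongr
  refine ⟨min (1 / b) (t ^ (1 - θ) / (4 * (K * b ^ (2 - θ)))), by positivity, ?_, ?_, hfin _ ?_⟩
  · calc _ ≤ 1 / b * b := by gcongr; exact min_le_left _ _
      _ = 1 := by field_simp
  · calc _ ≤ 4 * (K * b ^ (2 - θ)) * (t ^ (1 - θ) / (4 * (K * b ^ (2 - θ)))) := by
          gcongr; exact min_le_right _ _
      _ = _ := by field_simp
  · rcases min_choice (1 / b) (t ^ (1 - θ) / (4 * (K * b ^ (2 - θ)))) with h | h <;> rw [h]
    · calc _ ≤ A * L * W := div_le_self (by positivity) (by linarith)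
        _ ≤ t / b := h1
        _ = _ := by ring
    · have e : t ^ (1 - θ) / (4 * (K * b ^ (2 - θ))) * t = (t / b) ^ (2 - θ) / (4 * K) := by
        rw [Real.div_rpow ht.le hb.le, show 2 - θ = (1 - θ) + 1 by ring, Real.rpow_add ht,
          Real.rpow_one]
        field_simp
      rw [e]
      gcongr

theorem powerIndex_bounds {p : ℝ≥0∞} {q r s α : ℝ} (hr1 : r ≤ 1) (hs : 0 < s)
    (hα0 : 0 < α) (hα1 : α ≤ 1) (hθ0 : 0 < theta p q) :
    powerIndex p q r s α ≤ α * r ∧ powerIndex p q r s α ≤ 1 ∧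
    (powerIndex p q r s α + α * (1 - r) / 2) * (2 - theta p q) ≤ 1 ∧
    powerIndex p q r s α + α * (1 - r) / 2 ≤ 1 ∧
    s * (α / 2 + powerIndex p q r s α) ≤ 1 - powerIndex p q r s α * (2 - theta p q) := by
  have hθ1 := theta_le_one p q
  set θ := theta p q
  set Θ := powerIndex p q r s α with hdef
  have h1 : Θ ≤ α * r := min_le_left _ _
  have h2 : Θ ≤ (1 + α * r - α) / (2 - θ) := (min_le_right _ _).trans (min_le_left _ _)
  have h3 : Θ ≤ 1 / (2 + s - θ) - α * s / (1 + s) := (min_le_right _ _).trans (min_le_right _ _)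
  rw [le_div_iff₀ (by linarith)] at h2
  have h4 : 0 ≤ α * (1 - r) := mul_nonneg hα0.le (by linarith)
  have h5 : (Θ + α * (1 - r) / 2) * (2 - θ) ≤ 1 := by nlinarith
  refine ⟨h1, by nlinarith, h5, by nlinarith, ?_⟩
  have hA : 0 < 2 + s - θ := by linarith
  have h6 : Θ * (2 + s - θ) ≤ 1 - α * s / (1 + s) * (2 + s - θ) := by
    have := mul_le_mul_of_nonneg_right h3 hA.le
    rwa [sub_mul, one_div, inv_mul_cancel₀ hA.ne'] at this
  -- As `θ ≤ 1`, the third term of `Θ` reserves `α s` for the entropy; a ball of radius `m^(α/2)`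
  -- needs only half of it.
  have h7 : α * s ≤ α * s / (1 + s) * (2 + s - θ) := by
    rw [div_mul_eq_mul_div, le_div_iff₀ (by linarith)]
    exact mul_le_mul_of_nonneg_left (by linarith) (by positivity)
  have h8 : 0 < α * s := by positivity
  nlinarith

theorem insensitivity_le {γ : ℝ≥0∞} {β : ℝ} (h : ENNReal.ofReal β ≤ γ) {m : ℕ} (hm : 1 ≤ m) :
    insensitivity γ m ≤ (m : ℝ) ^ (-β) := by
  unfold insensitivity
  split_ifs with hγ
  · positivity
  · apply Real.rpow_le_rpow_of_exponent_le (by exact_mod_cast hm)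
    rw [neg_le_neg_iff]
    exact (ENNReal.ofReal_le_iff_le_toReal hγ).1 h

theorem one_add_log_le_mul_rpow {ϵ : ℝ} (hϵ : 0 < ϵ) {x : ℝ} (hx : 1 ≤ x) :
    1 + Real.log x ≤ (1 + 1 / ϵ) * x ^ ϵ := by
  have h1 := Real.log_le_rpow_div (by linarith : 0 ≤ x) hϵ
  have h2 := Real.one_le_rpow hx hϵ.le
  rw [add_mul, one_mul, one_div_mul_eq_div]
  linarith

end Exponents

/-! ### The regularization error and a near-minimizer. -/

section Approximation

variable {X : Type*} [MeasurableSpace X] (ρX : Measure X) (ρc : Kernel (X × X) ℝ)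

theorem risk_sub_risk_eq_excess [IsProbabilityMeasure ρX] [IsMarkovKernel ρc] {ks g : X × X → ℝ} (hks : Measurable ks) (hg : Measurable g)
    {A B C : ℝ} (hy : ∀ z, ∫⁻ y, ENNReal.ofReal |y| ∂(ρc z) ≤ ENNReal.ofReal C)
    (hA : ∀ z, |ks z| ≤ A) (hB : ∀ z, |g z| ≤ B) :
    risk ρX ρc g - risk ρX ρc ks = excess ρX ρc ks g := by
  have hy' : Integrable (fun w : (X × X) × ℝ => w.2) ((ρX.prod ρX) ⊗ₘ ρc) := by
    refine ⟨by fun_prop, ?_⟩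
    rw [hasFiniteIntegral_iff_norm, Measure.lintegral_compProd (by fun_prop)]
    refine (lintegral_mono (g := fun _ => ENNReal.ofReal C) hy).trans_lt ?_
    simp
  have hi : ∀ {h : X × X → ℝ} {D : ℝ}, Measurable h → (∀ z, |h z| ≤ D) →
      Integrable (fun w : (X × X) × ℝ => |w.2 - h w.1|) ((ρX.prod ρX) ⊗ₘ ρc) := by
    intro h D hm hD
    have : Integrable (fun w : (X × X) × ℝ => h w.1) ((ρX.prod ρX) ⊗ₘ ρc) :=
      Integrable.of_bound (hm.comp measurable_fst).aestronglyMeasurable D (.of_forall fun w => hD _)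
    exact (hy'.sub this).abs
  exact (integral_sub (hi hg hB) (hi hks hA)).symm

theorem exists_excess_add_le {H : Type*} [NormedAddCommGroup H] [InnerProductSpace ℝ H]
    [RKHS ℝ H (X × X) ℝ] {ks : X × X → ℝ} {r C₀ lam : ℝ}
    (h : regError H ρX ρc ks lam ≤ C₀ * lam ^ r) (hlam : 0 < lam)
    (heq : ∀ k : H, risk ρX ρc k - risk ρX ρc ks = excess ρX ρc ks k) :
    ∃ k : H, excess ρX ρc ks k + lam * ‖k‖ ^ 2 ≤ (max C₀ 0 + 1) * lam ^ r := by
  have hpow : 0 < lam ^ r := by positivity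
  have h1 : regError H ρX ρc ks lam < (max C₀ 0 + 1) * lam ^ r :=
    -- The infimum need not be attained; enlarging the constant makes the inequality strict, so some
    -- `k` lies below it.
    h.trans_lt (mul_lt_mul_of_pos_right (by linarith [le_max_left C₀ 0]) hpow)
  obtain ⟨k, hk⟩ := exists_lt_of_ciInf_lt h1
  exact ⟨k, by rw [← heq]; exact hk.le⟩

end Approximation

-- Instantiates the oracle inequality with `t` of order `(1 + log m) L m^(-Θ)`, `R` of order `L
-- m^(α/2)` and `b₀` of order `m^β`, where `β = α (1 - r) / 2`; every remaining term is then at most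
-- a constant times `t`.
set_option maxHeartbeats 1000000 in
theorem exists_excess_rate
    {X : Type*} [MetricSpace X] [CompactSpace X] [MeasurableSpace X] [BorelSpace X]
    {H : Type*} [NormedAddCommGroup H] [InnerProductSpace ℝ H] [CompleteSpace H]
    [RKHS ℝ H (X × X) ℝ] (hH : IsHyperRKHS (X := X) H)
    (ρX : Measure X) [IsProbabilityMeasure ρX] (ρc : Kernel (X × X) ℝ) [IsMarkovKernel ρc]
    {ks : X × X → ℝ} (hmed : ∀ z, IsMedian (ρc z) (ks z)) (hks : Measurable ks)
    {p : ℝ≥0∞} (hp : 0 < p) {q : ℝ} (hq : 1 < q) {K : ℝ} (hK : 1 ≤ K)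
    (hvar : ∀ b : ℝ, 1 ≤ b → ∀ g : X × X → ℝ, Measurable g → (∀ z, |g z - ks z| ≤ b) →
      0 ≤ excess ρX ρc ks g ∧
      ∫ z, (g z - ks z) ^ 2 ∂(ρX.prod ρX) ≤
        K * b ^ (2 - theta p q) * excess ρX ρc ks g ^ theta p q)
    {r : ℝ} (hr1 : r ≤ 1) (happrox : ApproxCondition H ρX ρc ks r)
    (hmoment : MomentHypothesis ρc) {s : ℝ} (hs : 0 < s) (hcover : CoveringCondition (X := X) H s)
    {α : ℝ} (hα0 : 0 < α) (hα1 : α ≤ 1) {γ : ℝ≥0∞} (hγ : ENNReal.ofReal (α * r) ≤ γ)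
    (hΘ : 0 < powerIndex p q r s α) (A : ℝ) :
    ∃ B₀ C : ℝ, 1 ≤ B₀ ∧ A ≤ B₀ ∧ 0 ≤ C ∧ (∀ z, |ks z| ≤ B₀) ∧
      ∀ m : ℕ, 2 ≤ m → ∀ L : ℝ, 1 ≤ L →
      ∃ E : Set (Sample X m), sampleLaw ρX ρc m E ≤ ENNReal.ofReal (4 * Real.exp (-L)) ∧
        ∀ S, S ∉ E → ∀ f : H,
          IsSVRSolution ((m : ℝ) ^ (-α)) (insensitivity γ m) S f →
          excess ρX ρc ks (fun z => proj (B₀ * (1 + Real.log m)) (f z)) ≤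
            C * (1 + Real.log m) * L * (m : ℝ) ^ (-powerIndex p q r s α) := by
  obtain ⟨M, c, hM, hc, hmom⟩ := hmoment
  obtain ⟨C₀, happ⟩ := happrox
  obtain ⟨Cs, hCs, hC⟩ := hcover
  obtain ⟨κ, hκ, hκb⟩ := exists_abs_apply_le hH
  have hθ0 := theta_pos hp hq
  have hθ1 := theta_le_one p q
  obtain ⟨x1, x2, x3, x4, x5⟩ := powerIndex_bounds (p := p) (q := q) hr1 hs hα0 hα1 hθ0
  set θ := theta p q
  set Θ := powerIndex p q r s α
  have hM0 : 0 < M := by linarith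
  have hy : ∀ z, ∫⁻ y, ENNReal.ofReal |y| ∂(ρc z) ≤ ENNReal.ofReal (c * M) := fun z => by
    simpa using hmom 1 le_rfl z
  have hksb : ∀ z, |ks z| ≤ 2 * (c * M) := fun z => abs_median_le (hmed z) (by positivity) (hy z)
  have hexp : ∀ z, ∫⁻ y, ENNReal.ofReal (Real.exp (|y| / (2 * M))) ∂(ρc z) ≤
      ENNReal.ofReal (2 * (1 + c)) := fun z =>
    lintegral_exp_abs_div_le hM0 hc fun ℓ hℓ => hmom ℓ hℓ z
  set Kₑ := 2 * (1 + c) with hKₑdef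
  have hKₑ : 1 ≤ Kₑ := by linarith
  have hlogK : 0 ≤ Real.log Kₑ := Real.log_nonneg hKₑ
  have hcM : 0 < c * M := by positivity
  obtain ⟨B₀, hB₀1, hB₀A, hB₀c, hB₀M⟩ : ∃ B₀ : ℝ, 1 ≤ B₀ ∧ A ≤ B₀ ∧ 2 * (c * M) ≤ B₀ ∧
      4 * M ≤ B₀ := ⟨max (max 1 A) (max (2 * (c * M)) (4 * M)), by simp, by simp, by simp, by simp⟩
  set C₁ := max C₀ 0 + 1 with hC₁def
  have hC₁ : 1 ≤ C₁ := by linarith [le_max_right C₀ 0]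
  set B₂ := κ * C₁ + B₀ with hB₂def
  have hB₂ : 1 ≤ B₂ :=
    (one_le_mul_of_one_le_of_one_le hκ hC₁).trans (le_add_of_nonneg_right (by linarith))
  set R₁ := 2 * M * (Real.log Kₑ + 1) + 1 with hR₁def
  have hR₁ : 1 ≤ R₁ := by
    have : 0 ≤ 2 * M * (Real.log Kₑ + 1) := by positivity
    linarith
  set D := Cs * R₁ ^ s + 1 with hDdef
  have hD : 1 ≤ D := by
    have : 0 ≤ Cs * R₁ ^ s := by positivity
    linarith
  -- The product form lets one `t` serve both step sizes: dividing by `2B` cancels `2B₀`, dividing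
  -- by `b₀` cancels `B₂`, and in each case `48 K D` survives to pay for the entropy constant `D`.
  set K₃ := 48 * K * D * (2 * B₀) * B₂ with hK₃def
  have hK₃ : 1 ≤ K₃ := by
    have h1 : 1 ≤ 48 * K := by linarith
    have h2 : 1 ≤ 2 * B₀ := by linarith
    exact one_le_mul_of_one_le_of_one_le (one_le_mul_of_one_le_of_one_le
      (one_le_mul_of_one_le_of_one_le h1 hD) h2) hB₂
  refine ⟨B₀, 5 * K₃ + 4 * C₁ + 4 * (2 * B₀ + B₂ + 1 + 2 * M * (Kₑ + 1)), hB₀1, hB₀A,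
    by positivity, fun z => (hksb z).trans hB₀c, ?_⟩
  intro m hm L hL
  have hm2 : (2 : ℝ) ≤ m := by exact_mod_cast hm
  have hm0 : (0 : ℝ) < m := by linarith
  have hm1 : (1 : ℝ) ≤ m := by linarith
  set β := α * (1 - r) / 2 with hβdef
  have hβ : 0 ≤ β := by
    have : 0 ≤ α * (1 - r) := mul_nonneg hα0.le (by linarith)
    positivity
  set ℓ := 1 + Real.log m with hℓdef
  have hlog : 0 ≤ Real.log m := Real.log_nonneg hm1
  have hℓ : 1 ≤ ℓ := by linarith
  set lam := (m : ℝ) ^ (-α) with hlamdef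
  have hlam : 0 < lam := by positivity
  have hlamr : lam ^ r = (m : ℝ) ^ (-(α * r)) := by
    rw [hlamdef, ← Real.rpow_mul hm0.le]; congr 1; ring
  have hrisk : ∀ k : H, risk ρX ρc k - risk ρX ρc ks = excess ρX ρc ks k := fun k =>
    risk_sub_risk_eq_excess ρX ρc hks (continuous_of_isHyperRKHS hH k).measurable hy hksb (hκb k)
  obtain ⟨k₀, hk₀⟩ := exists_excess_add_le ρX ρc (happ lam hlam) hlam hrisk
  rw [← hC₁def] at hk₀
  -- A crude sup bound suffices here; nonnegativity must come before the sharp bound on `‖k₀‖`,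
  -- which drops the excess.
  have hk₀Δ : 0 ≤ excess ρX ρc ks k₀ := by
    refine (hvar (max 1 (κ * ‖k₀‖ + 2 * (c * M))) (le_max_left _ _) k₀
      (continuous_of_isHyperRKHS hH k₀).measurable fun z => ?_).1
    refine le_trans ?_ (le_max_right _ _)
    exact (abs_sub _ _).trans (add_le_add (hκb k₀ z) (hksb z))
  have hk₀n : ‖k₀‖ ≤ C₁ * (m : ℝ) ^ β := by
    refine le_of_sq_le_sq ?_ (by positivity)
    have h1 : lam * ‖k₀‖ ^ 2 ≤ C₁ * lam ^ r := by linarith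
    have h2 : (C₁ * (m : ℝ) ^ β) ^ 2 * lam = C₁ ^ 2 * lam ^ r := by
      rw [hlamr, hlamdef, mul_pow, ← Real.rpow_natCast ((m : ℝ) ^ β), ← Real.rpow_mul hm0.le,
        mul_assoc, ← Real.rpow_add hm0]
      congr 2
      rw [hβdef]; push_cast; ring
    have h3 : C₁ * lam ^ r ≤ C₁ ^ 2 * lam ^ r := by
      gcongr; exact le_self_pow₀ hC₁ two_ne_zero
    refine le_of_mul_le_mul_left ?_ hlam
    linarith
  have hmβ : 1 ≤ (m : ℝ) ^ β := Real.one_le_rpow hm1 hβ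
  set b₀ := B₂ * (m : ℝ) ^ β with hb₀def
  have hb₀ : 1 ≤ b₀ := one_le_mul_of_one_le_of_one_le hB₂ hmβ
  have hk₀b : ∀ z, |k₀ z - ks z| ≤ b₀ := fun z => by
    refine (abs_sub _ _).trans ((add_le_add (hκb k₀ z) ((hksb z).trans hB₀c)).trans ?_)
    rw [hb₀def, hB₂def, add_mul]
    refine add_le_add ?_ (le_mul_of_one_le_right (by linarith) hmβ)
    rw [mul_assoc]
    exact mul_le_mul_of_nonneg_left hk₀n (by linarith)
  set B := B₀ * ℓ with hBdef
  have hB : B₀ ≤ B := le_mul_of_one_le_right (by linarith) hℓ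
  have hB1 : 1 ≤ B := hB₀1.trans hB
  have hBm : (m : ℝ) ^ 2 * Real.exp (-(B / (2 * M))) ≤ 1 := by
    -- This is the reason for requiring `4 * M ≤ B₀`.
    have h1 : 2 * Real.log m ≤ B / (2 * M) := by
      rw [le_div_iff₀ (by positivity)]
      calc 2 * Real.log m * (2 * M) = 4 * M * Real.log m := by ring
        _ ≤ B₀ * ℓ := mul_le_mul hB₀M (by linarith) hlog (by linarith)
    have h2 : Real.exp (-(B / (2 * M))) ≤ Real.exp (-(2 * Real.log m)) :=
      Real.exp_le_exp.2 (by linarith)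
    have h3 : Real.exp (-(2 * Real.log m)) = ((m : ℝ) ^ 2)⁻¹ := by
      rw [Real.exp_neg, mul_comm, Real.exp_mul, Real.exp_log hm0, Real.rpow_two]
    calc _ ≤ (m : ℝ) ^ 2 * ((m : ℝ) ^ 2)⁻¹ := by rw [← h3]; gcongr
      _ = 1 := mul_inv_cancel₀ (by positivity)
  set R := R₁ * L * (m : ℝ) ^ (α / 2) with hRdef
  have hR : 0 < R := by positivity
  have hRY : 2 * M * (Real.log Kₑ + L) ≤ lam * R ^ 2 := by
    have e : lam * R ^ 2 = (R₁ * L) ^ 2 := by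
      rw [hRdef, mul_pow, ← Real.rpow_natCast ((m : ℝ) ^ (α / 2)), ← Real.rpow_mul hm0.le, hlamdef,
        mul_left_comm, ← Real.rpow_add hm0]
      rw [show -α + α / 2 * ((2 : ℕ) : ℝ) = 0 by push_cast; ring, Real.rpow_zero, mul_one]
    rw [e]
    have h1 : 2 * M * (Real.log Kₑ + L) ≤ R₁ * L := by
      calc 2 * M * (Real.log Kₑ + L) ≤ 2 * M * (Real.log Kₑ * L + L) := by
            gcongr; exact le_mul_of_one_le_right hlogK hL
        _ ≤ 2 * M * (Real.log Kₑ * L + L) + L := le_add_of_nonneg_right (by positivity)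
        _ = R₁ * L := by rw [hR₁def]; ring
    have h2 : 1 ≤ R₁ * L := one_le_mul_of_one_le_of_one_le hR₁ hL
    exact h1.trans (le_self_pow₀ h2 two_ne_zero)
  set t := K₃ * ℓ * L * (m : ℝ) ^ (-Θ) with htdef
  have ht : 0 < t := by positivity
  obtain ⟨τ₁, t1, t2, t3, t4⟩ := exists_step_size (K := K) (θ := θ) (b := 2 * B) (t := t)
    (A := 48 * K * D * B₂) (L := L) (ν := Θ) hm hK hθ1 (by linarith) ht
    (one_le_mul_of_one_le_of_one_le (one_le_mul_of_one_le_of_one_le (by linarith) hD) hB₂) hL hΘ.le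
    (by
      rw [htdef, hK₃def, hBdef]
      refine le_of_eq ?_
      field_simp)
  obtain ⟨τ₀, u1, u2, u3, u4⟩ := exists_step_size (K := K) (θ := θ) (b := b₀) (t := t)
    (A := 48 * K * D * (2 * B₀)) (L := L) (ν := Θ + β) hm hK hθ1 (by linarith) ht
    (one_le_mul_of_one_le_of_one_le (one_le_mul_of_one_le_of_one_le (by linarith) hD)
      (by linarith)) hL (by linarith)
    (by
      have e : t / b₀ = 48 * K * D * (2 * B₀) * L * (m : ℝ) ^ (-(Θ + β)) * ℓ := by
        rw [htdef, hK₃def, hb₀def, neg_add, Real.rpow_add hm0, Real.rpow_neg hm0.le β]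
        field_simp
      rw [e]
      exact le_mul_of_one_le_right (by positivity) hℓ)
  have hω : 0 ≤ 1 - Θ * (2 - θ) := by
    refine le_trans ?_ x5
    positivity
  have hmω : 1 ≤ (m : ℝ) ^ (1 - Θ * (2 - θ)) := Real.one_le_rpow hm1 hω
  have hτ₁L : Cs * (R / t) ^ s + L ≤ (m / 2 : ℕ) * (τ₁ * t / 4) := by
    refine le_trans ?_ t4
    have e1 : R / t ≤ R₁ * (m : ℝ) ^ (α / 2 + Θ) := by
      rw [div_le_iff₀ ht, htdef, hRdef]
      have e2 : R₁ * (m : ℝ) ^ (α / 2 + Θ) * (K₃ * ℓ * L * (m : ℝ) ^ (-Θ)) =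
          R₁ * L * (m : ℝ) ^ (α / 2) * (K₃ * ℓ) := by
        rw [Real.rpow_add hm0, Real.rpow_neg hm0.le]
        field_simp
      rw [e2]
      exact le_mul_of_one_le_right (by positivity) (one_le_mul_of_one_le_of_one_le hK₃ hℓ)
    have e3 : (R / t) ^ s ≤ R₁ ^ s * (m : ℝ) ^ (1 - Θ * (2 - θ)) := by
      refine (Real.rpow_le_rpow (by positivity) e1 hs.le).trans ?_
      rw [Real.mul_rpow (by positivity) (by positivity), ← Real.rpow_mul hm0.le]
      gcongr
      linarith only [x5]
    calc Cs * (R / t) ^ s + L ≤ Cs * (R₁ ^ s * (m : ℝ) ^ (1 - Θ * (2 - θ))) + L := by gcongr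
      _ ≤ Cs * (R₁ ^ s * (m : ℝ) ^ (1 - Θ * (2 - θ))) * L + (m : ℝ) ^ (1 - Θ * (2 - θ)) * L := by
          refine add_le_add (le_mul_of_one_le_right (by positivity) hL)
            (le_mul_of_one_le_left (by linarith) hmω)
      _ = D * L * (m : ℝ) ^ (1 - Θ * (2 - θ)) := by rw [hDdef]; ring
      _ ≤ D * L * (m : ℝ) ^ (1 - Θ * (2 - θ)) * B₂ := le_mul_of_one_le_right (by positivity) hB₂
      _ = _ := by field_simp
  have hτ₀L : L ≤ (m / 2 : ℕ) * (τ₀ * t / 4) := by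
    refine le_trans ?_ u4
    have e : 48 * K * D * (2 * B₀) / (48 * K) * L * (m : ℝ) ^ (1 - (Θ + β) * (2 - θ)) =
        (D * (2 * B₀) * (m : ℝ) ^ (1 - (Θ + β) * (2 - θ))) * L := by field_simp
    rw [e]
    refine le_mul_of_one_le_left (by linarith) ?_
    exact one_le_mul_of_one_le_of_one_le (one_le_mul_of_one_le_of_one_le hD (by linarith))
      (Real.one_le_rpow hm1 (by linarith))
  obtain ⟨E, hE, hE'⟩ := exists_event_excess_le hH ρX ρc hks hθ0.le hθ1 hvar hM0 hKₑ hexp hC hm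
    hlam (insensitivity_nonneg γ m) hB1 (fun z => (hksb z).trans (hB₀c.trans hB)) hBm k₀ hb₀ hk₀b
    ht (by linarith) hR hRY t1 t2 t3 hτ₁L u1 u2 u3 hτ₀L
  refine ⟨E, hE, fun S hS f hf => (hE' S hS f hf).trans ?_⟩
  set Z := ℓ * L * (m : ℝ) ^ (-Θ) with hZdef
  have hZ1 : (m : ℝ) ^ (-Θ) ≤ Z := by
    rw [hZdef]
    exact le_mul_of_one_le_left (by positivity) (one_le_mul_of_one_le_of_one_le hℓ hL)
  have hmono : ∀ e : ℝ, e ≤ -Θ → (m : ℝ) ^ e ≤ Z := fun e he =>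
    (Real.rpow_le_rpow_of_exponent_le hm1 he).trans hZ1
  have y1 : excess ρX ρc ks k₀ + lam * ‖k₀‖ ^ 2 ≤ C₁ * Z := by
    refine hk₀.trans ?_
    rw [hlamr]
    gcongr
    exact hmono _ (by linarith)
  have y2 : insensitivity γ m ≤ Z := (insensitivity_le hγ (by omega)).trans (hmono _ (by linarith))
  have y3 : 2 * B / m ≤ 2 * B₀ * Z := by
    have : (m : ℝ)⁻¹ ≤ (m : ℝ) ^ (-Θ) := by
      rw [← Real.rpow_neg_one]
      exact Real.rpow_le_rpow_of_exponent_le hm1 (by linarith only [x2])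
    calc 2 * B / m = 2 * B₀ * (ℓ * 1 * (m : ℝ)⁻¹) := by rw [hBdef]; ring
      _ ≤ 2 * B₀ * Z := by rw [hZdef]; gcongr
  have y4 : b₀ / m ≤ B₂ * Z := by
    have e : b₀ / m = B₂ * (m : ℝ) ^ (β - 1) := by
      rw [hb₀def, Real.rpow_sub_one hm0.ne']; ring
    rw [e]
    gcongr
    exact hmono _ (by linarith)
  have y5 : 2 * M * (Kₑ + L) / (m : ℝ) ^ 2 ≤ 2 * M * (Kₑ + 1) * Z := by
    have h1 : Kₑ + L ≤ (Kₑ + 1) * L := by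
      rw [add_mul, one_mul]
      exact add_le_add_left (le_mul_of_one_le_right (by linarith only [hKₑ]) hL) L
    have h2 : ((m : ℝ) ^ 2)⁻¹ ≤ (m : ℝ) ^ (-Θ) := by
      rw [← Real.rpow_natCast, ← Real.rpow_neg hm0.le]
      refine Real.rpow_le_rpow_of_exponent_le hm1 ?_
      push_cast; linarith only [x2]
    calc 2 * M * (Kₑ + L) / (m : ℝ) ^ 2 ≤ 2 * M * ((Kₑ + 1) * L) * ((m : ℝ) ^ 2)⁻¹ := by
          rw [div_eq_mul_inv]; gcongr
      _ = 2 * M * (Kₑ + 1) * (1 * L * ((m : ℝ) ^ 2)⁻¹) := by ring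
      _ ≤ 2 * M * (Kₑ + 1) * Z := by rw [hZdef]; gcongr
  have y6 : t = K₃ * Z := by rw [htdef, hZdef]; ring
  rw [add_div, y6]
  have e : (5 * K₃ + 4 * C₁ + 4 * (2 * B₀ + B₂ + 1 + 2 * M * (Kₑ + 1))) * ℓ * L * (m : ℝ) ^ (-Θ) =
      (5 * K₃ + 4 * C₁ + 4 * (2 * B₀ + B₂ + 1 + 2 * M * (Kₑ + 1))) * Z := by rw [hZdef]; ring
  rw [e]
  linarith only [y1, y2, y3, y4, y5]

end HyperSVR

/-! ### From the excess rate to the norm bound. -/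

theorem theorem1
    {X : Type*} [MetricSpace X] [CompactSpace X] [MeasurableSpace X] [BorelSpace X]
    {H : Type*} [NormedAddCommGroup H] [InnerProductSpace ℝ H] [CompleteSpace H]
    [RKHS ℝ H (X × X) ℝ] (hH : IsHyperRKHS (X := X) H)
    (ρX : Measure X) [IsProbabilityMeasure ρX]
    (ρc : Kernel (X × X) ℝ) [IsMarkovKernel ρc]
    (kstar : X × X → ℝ) (hmed : ∀ z, IsMedian (ρc z) (kstar z))
    (Mstar : ℝ) (hMstar : 1 ≤ Mstar) (hbound : ∀ᵐ z ∂(ρX.prod ρX), |kstar z| ≤ Mstar)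
    (p : ℝ≥0∞) (hp : 0 < p) (q : ℝ) (hq : 1 < q)
    (hnoise : HasMedianOfAverageType ρX ρc p q)
    (r : ℝ) (hr0 : 0 < r) (hr1 : r ≤ 1) (happrox : ApproxCondition H ρX ρc kstar r)
    (hmoment : MomentHypothesis ρc)
    (s : ℝ) (hs : 0 < s) (hcover : CoveringCondition (X := X) H s)
    (α : ℝ) (hα0 : 0 < α) (hα1 : α ≤ 1) (hα : α < (1 + s) / (s * (2 + s - theta p q)))
    (γ : ℝ≥0∞) (hγ : ENNReal.ofReal (α * r) ≤ γ)
    (ϵ : ℝ) (hϵ0 : 0 < ϵ) (hϵ : ϵ < powerIndex p q r s α / q) :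
    ∃ C : ℝ, 0 < C ∧ ∀ m : ℕ, 1 ≤ m →
      (∀ S : Sample X m, ∃! k : H,
        IsSVRSolution ((m : ℝ) ^ (-α)) (insensitivity γ m) S k) ∧
      ∀ kz : Sample X m → H,
        (∀ S, IsSVRSolution ((m : ℝ) ^ (-α)) (insensitivity γ m) S (kz S)) →
        ∀ δ : ℝ, 0 < δ → δ < 1 →
          sampleLaw ρX ρc m
            {S | ¬ eLpNorm (fun z => proj Mstar (kz S z) - kstar z) (pStar p q) (ρX.prod ρX) ≤
              ENNReal.ofReal (C * Real.log (4 / δ) ^ (1 / q) *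
                (m : ℝ) ^ (ϵ - powerIndex p q r s α / q))} ≤ ENNReal.ofReal δ := by
  have hq0 : 0 < q := by linarith
  have hΘ : 0 < powerIndex p q r s α := by
    have := hϵ0.trans hϵ
    rwa [div_pos_iff_of_pos_right hq0] at this
  obtain ⟨hks, K, hK, hexc⟩ := excess_bounds_of_averageType ρX ρc hp hq hmed hnoise
  obtain ⟨B₀, C₅, hB₀, hMB, hC₅, hksb, hrate⟩ := exists_excess_rate hH ρX ρc hmed hks hp hq hK
    (fun b hb g hg hgb => ⟨(hexc b hb g hg hgb).1, (hexc b hb g hg hgb).2.1⟩)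
    hr1 happrox hmoment hs hcover hα0 hα1 hγ hΘ Mstar
  have hMs0 : 0 ≤ Mstar := by linarith
  set Θ := powerIndex p q r s α
  set C₆ := (K * (2 * B₀) ^ (q - 1) * C₅) ^ (1 / q) with hC₆
  have hC₆0 : 0 ≤ C₆ := by positivity
  refine ⟨max (2 * Mstar) (C₆ * (1 + 1 / ϵ)), lt_max_of_lt_left (by linarith), ?_⟩
  intro m hm
  have hm1 : (1 : ℝ) ≤ m := by exact_mod_cast hm
  have hm0 : (0 : ℝ) < m := by linarith
  refine ⟨fun S => existsUnique_isSVRSolution (by positivity) _ S, ?_⟩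
  intro kz hkz δ hδ0 hδ1
  set L := Real.log (4 / δ) with hLdef
  have hL : 1 ≤ L := by
    rw [hLdef, Real.le_log_iff_exp_le (by positivity)]
    have h1 : (4 : ℝ) ≤ 4 / δ := by rw [le_div_iff₀ hδ0]; linarith
    linarith [Real.exp_one_lt_d9]
  have hLq : 1 ≤ L ^ (1 / q) := Real.one_le_rpow hL (by positivity)
  -- A single point has no off-diagonal pair; for `m = 1` the trivial bound `2 * Mstar` is built
  -- into the constant.
  rcases Nat.lt_or_ge m 2 with hm2 | hm2
  · obtain rfl : m = 1 := by omega
    have hempty : {S : Sample X 1 | ¬ eLpNorm (fun z => proj Mstar (kz S z) - kstar z) (pStar p q)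
        (ρX.prod ρX) ≤ ENNReal.ofReal (max (2 * Mstar) (C₆ * (1 + 1 / ϵ)) * L ^ (1 / q) *
          ((1 : ℕ) : ℝ) ^ (ϵ - Θ / q))} = ∅ := by
      refine eq_empty_of_forall_notMem fun S hS => hS ?_
      have hle : ∀ᵐ z ∂(ρX.prod ρX), ‖proj Mstar (kz S z) - kstar z‖ ≤ 2 * Mstar := by
        filter_upwards [hbound] with z hz
        refine (abs_sub _ _).trans ?_
        linarith [abs_proj_le hMs0 (kz S z)]
      have hps : pStar p q ≠ 0 := by
        rw [pStar]
        refine mul_ne_zero (fun h => ?_) (by simpa using hq0)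
        have := pRatio_toReal_pos hp
        simp [h] at this
      refine (eLpNorm_le_of_ae_bound hle).trans ?_
      simp only [measure_univ, ENNReal.one_rpow, one_mul, Nat.cast_one, Real.one_rpow, mul_one]
      apply ENNReal.ofReal_le_ofReal
      refine (le_max_left _ _).trans (le_mul_of_one_le_right ?_ hLq)
      exact le_max_of_le_left (by linarith)
    rw [hempty, measure_empty]
    exact zero_le
  · obtain ⟨E, hE, hE'⟩ := hrate m hm2 L hL
    have hEδ : 4 * Real.exp (-L) = δ := by
      rw [Real.exp_neg, hLdef, Real.exp_log (by positivity)]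
      field_simp
    rw [hEδ] at hE
    refine (measure_mono fun S hS => ?_).trans hE
    by_contra hSE
    refine hS ?_
    set ℓ := 1 + Real.log m with hℓdef
    have hlog : 0 ≤ Real.log m := Real.log_nonneg hm1
    have hℓ : 1 ≤ ℓ := by linarith
    set B := B₀ * ℓ with hBdef
    have hB : B₀ ≤ B := le_mul_of_one_le_right (by linarith) hℓ
    have hB0 : 0 ≤ B := by linarith
    have hΔ := hE' S hSE (kz S) (hkz S)
    have hmeas : Measurable fun z => proj B (kz S z) :=
      (measurable_proj B).comp (continuous_of_isHyperRKHS hH (kz S)).measurable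
    obtain ⟨h0, -, h2⟩ := hexc (2 * B) (by linarith) _ hmeas (fun z => by
      refine (abs_sub _ _).trans ?_
      linarith [abs_proj_le hB0 (kz S z), hksb z])
    have h3 : eLpNorm (fun z => proj Mstar (kz S z) - kstar z) (pStar p q) (ρX.prod ρX) ≤
        eLpNorm (fun z => proj B (kz S z) - kstar z) (pStar p q) (ρX.prod ρX) := by
      refine eLpNorm_mono_ae ?_
      filter_upwards [hbound] with z hz
      exact abs_proj_sub_le_of_abs_le hMs0 (hMB.trans hB) hz
    refine h3.trans (h2.trans (ENNReal.ofReal_le_ofReal ?_))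
    -- The sup bound contributes `ℓ^(q-1)` and the rate one more `ℓ`, so the `q`-th root leaves a
    -- single factor `ℓ`, absorbed by `m^ϵ`.
    have h4 : K * (2 * B) ^ (q - 1) * excess ρX ρc kstar (fun z => proj B (kz S z)) ≤
        (K * (2 * B₀) ^ (q - 1) * C₅) * ℓ ^ q * L * (m : ℝ) ^ (-Θ) := by
      calc _ ≤ K * (2 * B) ^ (q - 1) * (C₅ * ℓ * L * (m : ℝ) ^ (-Θ)) := by gcongr
        _ = _ := by
          rw [hBdef, ← mul_assoc 2, Real.mul_rpow (by positivity) (by positivity),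
            Real.rpow_sub_one (by positivity : ℓ ≠ 0)]
          field_simp
    calc _ ≤ ((K * (2 * B₀) ^ (q - 1) * C₅) * ℓ ^ q * L * (m : ℝ) ^ (-Θ)) ^ (1 / q) := by
          gcongr
      _ = C₆ * ℓ * L ^ (1 / q) * (m : ℝ) ^ (-Θ / q) := by
          rw [Real.mul_rpow (by positivity) (by positivity),
            Real.mul_rpow (by positivity) (by positivity),
            Real.mul_rpow (by positivity) (by positivity), ← hC₆, ← Real.rpow_mul (by positivity),
            ← Real.rpow_mul (by positivity), mul_one_div_cancel hq0.ne', Real.rpow_one,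
            mul_one_div]
      _ ≤ C₆ * ((1 + 1 / ϵ) * (m : ℝ) ^ ϵ) * L ^ (1 / q) * (m : ℝ) ^ (-Θ / q) := by
          gcongr
          exact one_add_log_le_mul_rpow hϵ0 hm1
      _ = C₆ * (1 + 1 / ϵ) * L ^ (1 / q) * (m : ℝ) ^ (ϵ - Θ / q) := by
          rw [sub_eq_add_neg, Real.rpow_add hm0, neg_div]
          ring
      _ ≤ _ := by
          gcongr
          exact le_max_right _ _
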